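/- Let $d=2$, let $p_0\ge 1$ be an integer and let $1-\frac{1}{2(2p_0-1)}<\alpha<1$. For $n\ge 1$ write $\mathbf{x}_n=(x_1,\dots,x_n)$, $\mathbf{x}'_n=(x'_1,\dots,x'_n)$ with $x_i,x'_i\in\mathbb{R}^2$, and $$S^{(n,\alpha)}=\prod_{i=1}^{n}(1-\Delta_{x_i})^{\alpha/2}(1-\Delta_{x'_i})^{\alpha/2},$$ acting in the spatial variables. For a kernel $\gamma^{(k+p)}(t,\mathbf{x}_{k+p},\mathbf{x}'_{k+p})$ and $1\le j\le k$ let $B_{j;k+1,\dots,k+p}\gamma^{(k+p)}=B^{+}_{j;k+1,\dots,k+p}\gamma^{(k+p)}-B^{-}_{j;k+1,\dots,k+p}\gamma^{(k+p)}$, where $$\big(B^{+}_{j;k+1,\dots,k+p}\gamma^{(k+p)}\big)(t,\mathbf{x}_k,\mathbf{x}'_k)=\int\prod_{l=1}^{p}\delta(x_j-x_{k+l})\,\delta(x_j-x'_{k+l})\;\gamma^{(k+p)}(t,\mathbf{x}_{k+p},\mathbf{x}'_{k+p})\,dx_{k+1}dx'_{k+1}\cdots dx_{k+p}dx'_{k+p}$$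 and $B^{-}_{j;k+1,\dots,k+p}$ is given by the same formula with $x'_j$ in place of $x_j$ in the delta functions. These integrals are understood as limits, in the sense of tempered distributions in $(t,\mathbf{x}_k,\mathbf{x}'_k)$, of the integrals in which $\delta$ is replaced by $\delta_\varepsilon(y)=\varepsilon^{-2}h(y/\varepsilon)$, $\varepsilon\downarrow 0$, the limit being required to exist and to be the same for every real Schwartz function $h$ on $\mathbb{R}^2$ with $\int h=1$. Then there is a constant $C_\alpha$, depending only on $\alpha$ and $p_0$, such that the following holds for all integers $1\le p\le p_0$, $k\ge 1$ and $1\le j\le k$. Let $\gamma_0^{(k+p)}\in L^2(\mathbb{R}^{2(k+p)}\times\mathbb{R}^{2(k+p)})$ satisfy $\|S^{(k+p,\alpha)}\gamma_0^{(k+p)}\|_{L^2}<\infty$, and let $\gamma^{(k+p)}\in C(\mathbb{R};L^2(\mathbb{R}^{2(k+p)}\times\mathbb{R}^{2(k+p)}))$ be the (weak) solution of $$i\partial_t\gamma^{(k+p)}+(\Delta_{\mathbf{x}_{k+p}}-\Delta_{\mathbf{x}'_{k+p}})\gamma^{(k+p)}=0,\qquad \gamma^{(k+p)}(0,\cdot)=\gamma_0^{(k+p)}.$$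 Then $B_{j;k+1,\dots,k+p}\gamma^{(k+p)}$ is well defined, $S^{(k,\alpha)}B_{j;k+1,\dots,k+p}\gamma^{(k+p)}$ is square integrable in space-time, and $$\big\|S^{(k,\alpha)}B_{j;k+1,\dots,k+p}\gamma^{(k+p)}\big\|_{L^2_{t,\mathbf{x}_k,\mathbf{x}'_k}(\mathbb{R}\times\mathbb{R}^{2k}\times\mathbb{R}^{2k})}\le C_\alpha\,\big\|S^{(k+p,\alpha)}\gamma_0^{(k+p)}\big\|_{L^2(\mathbb{R}^{2(k+p)}\times\mathbb{R}^{2(k+p)})}.$$ -/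

import Mathlib

open MeasureTheory Filter Topology
open scoped ENNReal NNReal SchwartzMap LineDeriv

noncomputable section

/-- The one-particle space `ℝ²`. -/
abbrev Plane : Type := EuclideanSpace ℝ (Fin 2)

/-- `ℝ^{2n} × ℝ^{2n}`, the space of pairs `(𝐱ₙ; 𝐱'ₙ)`. The coordinate `(false, i, a)` is the `a`-th
coordinate of `xᵢ`, the coordinate `(true, i, a)` is the `a`-th coordinate of `x'ᵢ`. -/
abbrev Config (n : ℕ) : Type := EuclideanSpace ℝ (Bool × Fin n × Fin 2)

/-- `ℝ × ℝ^{2n} × ℝ^{2n}`, the space of triples `(t, 𝐱ₙ, 𝐱'ₙ)`. -/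
abbrev SpaceTime (n : ℕ) : Type := EuclideanSpace ℝ (Unit ⊕ (Bool × Fin n × Fin 2))

/-- The position `xᵢ` (for `s = false`) or `x'ᵢ` (for `s = true`). -/
def particle {n : ℕ} (s : Bool) (i : Fin n) (z : Config n) : Plane :=
  WithLp.toLp 2 fun a => z (s, i, a)

/-- The point `(t, z)` of space-time. -/
def spaceTimePoint {n : ℕ} (t : ℝ) (z : Config n) : SpaceTime n :=
  WithLp.toLp 2 (Sum.elim (fun _ => t) fun b => z b)

/-- The spatial part of a point of space-time. -/
def spatialPart {n : ℕ} (w : SpaceTime n) : Config n :=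
  WithLp.toLp 2 fun b => w (Sum.inr b)

/-- `(x₁,…,x_{k+p}; x'₁,…,x'_{k+p}) ↦ (x₁,…,x_k; x'₁,…,x'_k)`. -/
def firstParticles (k p : ℕ) (z : Config (k + p)) : Config k :=
  WithLp.toLp 2 fun b => z (b.1, Fin.castAdd p b.2.1, b.2.2)

/-- The `L²` norm of a tempered distribution, equal to `∞` if it is not given by an `L²` function. -/
def l2Norm {E : Type*} [NormedAddCommGroup E] [InnerProductSpace ℝ E] [FiniteDimensional ℝ E]
    [MeasurableSpace E] [BorelSpace E] (u : 𝓢'(E, ℂ)) : ℝ≥0∞ :=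
  ⨅ (g : Lp ℂ 2 (volume : Measure E))
    (_ : Lp.toTemperedDistribution g = u), ‖g‖ₑ

/-- The symbol `∏ⱼ ⟨2π ξⱼ⟩^α ⟨2π ξ'ⱼ⟩^α` of `∏ⱼ (1 - Δ_{xⱼ})^{α/2} (1 - Δ_{x'ⱼ})^{α/2}`, for the
Fourier transform with kernel `exp(-2πi x·ξ)`. -/
def sobolevSymbol {n : ℕ} (α : ℝ) (ξ : Config n) : ℝ :=
  ∏ s : Bool, ∏ i : Fin n, (1 + (2 * Real.pi) ^ 2 * ‖particle s i ξ‖ ^ 2) ^ (α / 2)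

/-- `S^{(n,α)} = ∏ⱼ (1 - Δ_{xⱼ})^{α/2} (1 - Δ_{x'ⱼ})^{α/2}` on tempered distributions in
`(𝐱ₙ, 𝐱'ₙ)`. -/
def sobolevOp (n : ℕ) (α : ℝ) : 𝓢'(Config n, ℂ) →L[ℂ] 𝓢'(Config n, ℂ) :=
  TemperedDistribution.fourierMultiplierCLM ℂ fun ξ => (sobolevSymbol α ξ : ℂ)

/-- `S^{(n,α)}`, acting in the spatial variables only, on tempered distributions in
`(t, 𝐱ₙ, 𝐱'ₙ)`. -/
def sobolevOpSpaceTime (n : ℕ) (α : ℝ) : 𝓢'(SpaceTime n, ℂ) →L[ℂ] 𝓢'(SpaceTime n, ℂ) :=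
  TemperedDistribution.fourierMultiplierCLM ℂ fun w => (sobolevSymbol α (spatialPart w) : ℂ)

/-- The symbols above are smooth of temperate growth, as Fourier multipliers require. -/
theorem sobolevSymbol_comp_hasTemperateGrowth {n : ℕ} (α : ℝ) {E : Type*} [NormedAddCommGroup E]
    [NormedSpace ℝ E] [FiniteDimensional ℝ E] (L : E →ₗ[ℝ] Config n) :
    (fun w : E => (sobolevSymbol α (L w) : ℂ)).HasTemperateGrowth := by
  have prod_growth : ∀ {ι : Type} (S : Finset ι) (f : ι → E → ℝ),
      (∀ i, (f i).HasTemperateGrowth) → (fun w => ∏ i ∈ S, f i w).HasTemperateGrowth := by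
    intro ι S f hf
    classical
    induction S using Finset.induction_on with
    | empty => simp
    | insert a S ha ih =>
      simp only [Finset.prod_insert ha]
      exact (hf a).fun_mul ih
  have key : ∀ (s : Bool) (i : Fin n), (fun w : E =>
      (1 + (2 * Real.pi) ^ 2 * ‖particle s i (L w)‖ ^ 2) ^ (α / 2)).HasTemperateGrowth := by
    intro s i
    let P : E →ₗ[ℝ] Plane :=
      { toFun := fun w => (2 * Real.pi) • particle s i (L w)
        map_add' := by
          intro x y
          ext a
          simp [particle, mul_add]
        map_smul' := by
          intro c x
          ext a
          simp [particle]
          ring }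
    have hP := (Function.hasTemperateGrowth_one_add_norm_sq_rpow Plane (α / 2)).comp
      (LinearMap.toContinuousLinearMap P).hasTemperateGrowth
    have hfun : (fun w : E => (1 + (2 * Real.pi) ^ 2 * ‖particle s i (L w)‖ ^ 2) ^ (α / 2)) =
        (fun x : Plane => (1 + ‖x‖ ^ 2) ^ (α / 2)) ∘ ⇑(LinearMap.toContinuousLinearMap P) := by
      funext w
      simp [P, norm_smul, mul_pow]
    rw [hfun]
    exact hP
  exact Function.Complex.hasTemperateGrowth_ofReal.comp
    (prod_growth _ _ fun s => prod_growth _ _ fun i => key s i)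

theorem sobolevSymbol_hasTemperateGrowth {n : ℕ} (α : ℝ) :
    (fun ξ : Config n => (sobolevSymbol α ξ : ℂ)).HasTemperateGrowth :=
  sobolevSymbol_comp_hasTemperateGrowth α LinearMap.id

theorem sobolevSymbol_spatialPart_hasTemperateGrowth {n : ℕ} (α : ℝ) :
    (fun w : SpaceTime n => (sobolevSymbol α (spatialPart w) : ℂ)).HasTemperateGrowth :=
  sobolevSymbol_comp_hasTemperateGrowth α
    { toFun := spatialPart
      map_add' := by
        intro x y
        ext b
        simp [spatialPart]
      map_smul' := by
        intro c x
        ext b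
        simp [spatialPart] }

/-- The partial Laplacian `Δ_{𝐱ₙ}` (for `s = false`) or `Δ_{𝐱'ₙ}` (for `s = true`). -/
def partialLaplacian {n : ℕ} (s : Bool) (φ : 𝓢(Config n, ℂ)) : 𝓢(Config n, ℂ) :=
  ∑ i : Fin n, ∑ a : Fin 2,
    ∂_{EuclideanSpace.single (s, i, a) (1 : ℝ)} (∂_{EuclideanSpace.single (s, i, a) (1 : ℝ)} φ)

/-- `γ ∈ C(ℝ; L²)` is the (weak) solution of `i ∂ₜγ + (Δ_{𝐱ₙ} - Δ_{𝐱'ₙ}) γ = 0`, `γ(0) = γ₀`. -/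
structure IsFreeSolution {n : ℕ} (γ : ℝ → Lp ℂ 2 (volume : Measure (Config n)))
    (γ₀ : Lp ℂ 2 (volume : Measure (Config n))) : Prop where
  continuous : Continuous γ
  initial : γ 0 = γ₀
  equation : ∀ (φ : 𝓢(Config n, ℂ)) (t : ℝ), ∃ D : ℂ,
    HasDerivAt (fun s => ∫ z, φ z * γ s z) D t ∧
      Complex.I * D +
        ∫ z, (partialLaplacian false φ - partialLaplacian true φ) z * γ t z = 0

/-- The approximation `ε⁻² h(y / ε)` of the delta function on `ℝ²`. -/
def approxDelta (h : 𝓢(Plane, ℝ)) (ε : ℝ) (y : Plane) : ℝ :=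
  (ε ^ 2)⁻¹ * h (ε⁻¹ • y)

/-- `∏ₗ δ_ε(xⱼ - x_{k+l}) δ_ε(xⱼ - x'_{k+l})` for `s = false`, and the same product with `x'ⱼ` in the
place of `xⱼ` for `s = true`. -/
def contractionKernel {k p : ℕ} (h : 𝓢(Plane, ℝ)) (ε : ℝ) (s : Bool) (j : Fin k)
    (z : Config (k + p)) : ℝ :=
  ∏ l : Fin p,
    approxDelta h ε (particle s (Fin.castAdd p j) z - particle false (Fin.natAdd k l) z) *
      approxDelta h ε (particle s (Fin.castAdd p j) z - particle true (Fin.natAdd k l) z)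

/-- `β` is `B⁺_{j;k+1,…,k+p} γ` (for `s = false`) or `B⁻_{j;k+1,…,k+p} γ` (for `s = true`), as a
distribution in `(t, 𝐱_k, 𝐱'_k)`:
`β = lim_{ε → 0} ∫ ∏ₗ δ_ε(xⱼ - x_{k+l}) δ_ε(xⱼ - x'_{k+l}) γ(t, 𝐱_{k+p}; 𝐱'_{k+p}) dx_{k+1} ⋯ dx'_{k+p}`
(resp. with `x'ⱼ` in the place of `xⱼ`), the limit being taken against Schwartz functions, for all
approximations `δ_ε` of the delta function by a rescaled Schwartz function of integral one. -/
def IsHalfContraction {k p : ℕ} (s : Bool) (j : Fin k)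
    (γ : ℝ → Lp ℂ 2 (volume : Measure (Config (k + p)))) (β : 𝓢'(SpaceTime k, ℂ)) : Prop :=
  ∀ h : 𝓢(Plane, ℝ), ∫ y, h y = 1 → ∀ Φ : 𝓢(SpaceTime k, ℂ),
    Tendsto (fun ε : ℝ => ∫ t : ℝ, ∫ z : Config (k + p),
        Φ (spaceTimePoint t (firstParticles k p z)) * (contractionKernel h ε s j z : ℂ) * γ t z)
      (𝓝[>] 0) (𝓝 (β Φ))

/-- `β = B_{j;k+1,…,k+p} γ = B⁺_{j;k+1,…,k+p} γ - B⁻_{j;k+1,…,k+p} γ`. -/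
def IsContraction {k p : ℕ} (j : Fin k)
    (γ : ℝ → Lp ℂ 2 (volume : Measure (Config (k + p)))) (β : 𝓢'(SpaceTime k, ℂ)) : Prop :=
  ∃ βp βm : 𝓢'(SpaceTime k, ℂ),
    IsHalfContraction false j γ βp ∧ IsHalfContraction true j γ βm ∧ β = βp - βm

end

/-! On the Fourier side a free solution is `𝓕 γ₀` multiplied by exp(2πi t ω(ξ)), where ω is
quadratic with opposite signs for primed and unprimed particles, and a contraction adds all
contracted frequencies to the frequency of the particle at (s, j). So the half contraction tested
against Φ is the integral of `𝓕⁻ Φ (contractPoint s j ξ) * (𝓕 γ₀) ξ`. By duality and Cauchy–Schwarz,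
the estimate says that the pullback of χ along `contractPoint`, weighted by the quotient of the
Sobolev symbols, is bounded from L² of space-time to L². Equivalently, the image under
`contractPoint` of Lebesgue measure with the squared weight has bounded density:
`exists_lintegral_contractPoint_le`.

In sheared coordinates the symbols of all particles not taking part in the collision cancel, so no
constant depends on k. What is left is an integral over 2p + 1 frequencies with given sum ζ
(`exists_lintegral_collision_le`). The largest of them absorbs ⟨ζ⟩^{2α}; the other 2p become the
integration variables. One of these has the sign opposite to the discarded frequency, so the two
squares cancel and the phase is affine in it, with gradient ±4πA, where A is ζ minus the other 2p -
1 variables. Integrating that variable out costs a factor |A|⁻¹ and needs α > 1/2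
(`exists_lintegral_bracketWeight_mul_comp_inner_le`). The remaining integral of |ζ - ∑ yᵢ|⁻¹ ∏
⟨yᵢ⟩^{-2α} over 2p - 1 variables is bounded uniformly in ζ by Hölder's inequality
(`exists_lintegral_inv_remainder_mul_bracketWeight_le`). The kernel |v|⁻¹ on the plane just fails to
be in L² both at 0 and at infinity; its tail is what requires (2p - 1)(1 - α) < 1/2, the hypothesis
on α.

The regularised contraction is the same frequency integral with bounded factors, the values at the
contracted frequencies of the Fourier transform of δ_ε, inserted (`integral_contractionKernel_eq`).
These factors tend to 1. The estimate above makes the limit integral absolutely convergent, so the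
limit exists by dominated convergence and does not depend on h. -/

noncomputable section

/-! ### Coordinates on configurations and measure-preserving changes of variables -/

/-- The configuration with first `k` particles `q.2` and last `p` particles `q.1`. -/
def joinConfig (k p : ℕ) (q : (Bool × Fin p → Plane) × Config k) : Config (k + p) :=
  WithLp.toLp 2 fun b =>
    Fin.addCases (fun i => q.2 (b.1, i, b.2.2)) (fun l => q.1 (b.1, l) b.2.2) b.2.1

@[simp]
theorem particle_castAdd_joinConfig {k p : ℕ} (q : (Bool × Fin p → Plane) × Config k) (s : Bool)
    (i : Fin k) : particle s (Fin.castAdd p i) (joinConfig k p q) = particle s i q.2 := by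
  ext a; simp [particle, joinConfig]

@[simp]
theorem particle_natAdd_joinConfig {k p : ℕ} (q : (Bool × Fin p → Plane) × Config k) (s : Bool)
    (l : Fin p) : particle s (Fin.natAdd k l) (joinConfig k p q) = q.1 (s, l) := by
  ext a; simp [particle, joinConfig]

@[simp]
theorem firstParticles_joinConfig {k p : ℕ} (q : (Bool × Fin p → Plane) × Config k) :
    firstParticles k p (joinConfig k p q) = q.2 := by
  ext b; simp [firstParticles, joinConfig]

@[simp]
theorem spatialPart_spaceTimePoint {n : ℕ} (t : ℝ) (z : Config n) :
    spatialPart (spaceTimePoint t z) = z := by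
  ext b; simp [spatialPart, spaceTimePoint]

theorem volume_toLp_preimage_pi {ι : Type*} [Fintype ι] (s : ι → Set ℝ)
    (hs : ∀ i, MeasurableSet (s i)) :
    volume {v : EuclideanSpace ℝ ι | ∀ i, v i ∈ s i} = ∏ i, volume (s i) := by
  have h := (PiLp.volume_preserving_ofLp ι).measure_preimage
    (MeasurableSet.univ_pi hs).nullMeasurableSet
  rw [volume_pi_pi] at h
  rw [← h]
  congr 1
  ext v
  simp

theorem measurable_euclidean_iff {X ι : Type*} [MeasurableSpace X] [Fintype ι]
    {f : X → EuclideanSpace ℝ ι} : Measurable f ↔ ∀ i, Measurable fun x => f x i := by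
  constructor
  · intro h i
    exact (measurable_pi_apply i).comp ((WithLp.measurable_ofLp 2 _).comp h)
  · intro h
    exact (WithLp.measurable_toLp 2 _).comp (measurable_pi_lambda _ h)

theorem measurable_joinConfig (k p : ℕ) : Measurable (joinConfig k p) := by
  rw [measurable_euclidean_iff]
  rintro ⟨s, i, a⟩
  refine Fin.addCases (fun i => ?_) (fun l => ?_) i
  · simp only [joinConfig, Fin.addCases_left]
    exact (measurable_euclidean_iff.1 measurable_snd (s, i, a))
  · simp only [joinConfig, Fin.addCases_right]
    exact (measurable_euclidean_iff.1 ((measurable_pi_apply (s, l)).comp measurable_fst) a)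

/-- Boxes determine Lebesgue measure, so a regrouping of coordinates only needs a comparison of
products of side lengths. -/
theorem measurePreserving_of_boxes {X ι : Type*} [MeasureSpace X] [Fintype ι]
    {f : X → EuclideanSpace ℝ ι} (hf : Measurable f)
    (h : ∀ s : ι → Set ℝ, (∀ i, MeasurableSet (s i)) →
      volume {x | ∀ i, f x i ∈ s i} = ∏ i, volume (s i)) :
    MeasurePreserving f volume volume := by
  have hf' : MeasurePreserving (fun x => (f x).ofLp) volume volume := by
    have hm : Measurable fun x => (f x).ofLp := (WithLp.measurable_ofLp 2 _).comp hf
    refine ⟨hm, ?_⟩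
    rw [volume_pi]
    symm
    refine Measure.pi_eq fun s hs => ?_
    rw [Measure.map_apply hm (MeasurableSet.univ_pi hs), ← h s hs]
    congr 1
    ext x
    simp
  have := (PiLp.volume_preserving_toLp ι).comp hf'
  exact this

theorem measurePreserving_joinConfig (k p : ℕ) :
    MeasurePreserving (joinConfig k p) volume volume := by
  refine measurePreserving_of_boxes (measurable_joinConfig k p) fun s hs => ?_
  have : {q : (Bool × Fin p → Plane) × Config k | ∀ i, joinConfig k p q i ∈ s i} =
      (Set.univ.pi fun b : Bool × Fin p =>
        {v : Plane | ∀ a, v a ∈ s (b.1, Fin.natAdd k b.2, a)}) ×ˢ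
      {x : Config k | ∀ b, x b ∈ s (b.1, Fin.castAdd p b.2.1, b.2.2)} := by
    ext q
    simp only [Set.mem_ofPred_eq, Set.mem_prod, Set.mem_univ_pi, Prod.forall]
    constructor
    · intro h
      refine ⟨fun b l a => ?_, fun b i a => ?_⟩
      · simpa [joinConfig] using h b (Fin.natAdd k l) a
      · simpa [joinConfig] using h b (Fin.castAdd p i) a
    · rintro ⟨h1, h2⟩ b i a
      refine Fin.addCases (fun i => ?_) (fun l => ?_) i
      · simpa [joinConfig] using h2 b i a
      · simpa [joinConfig] using h1 b l a
  rw [this, Measure.volume_eq_prod, Measure.prod_prod, volume_pi_pi,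
    volume_toLp_preimage_pi _ (fun _ => hs _)]
  simp_rw [volume_toLp_preimage_pi _ (fun _ => hs _)]
  simp only [Fintype.prod_prod_type, Fin.prod_univ_add, Finset.prod_mul_distrib]
  ring

theorem measurable_spaceTimePoint (k : ℕ) :
    Measurable fun q : ℝ × Config k => spaceTimePoint q.1 q.2 := by
  rw [measurable_euclidean_iff]
  rintro (i | b)
  · exact measurable_fst
  · exact measurable_euclidean_iff.1 measurable_snd b

theorem measurePreserving_spaceTimePoint (k : ℕ) :
    MeasurePreserving (fun q : ℝ × Config k => spaceTimePoint q.1 q.2) volume volume := by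
  refine measurePreserving_of_boxes (measurable_spaceTimePoint k) fun s hs => ?_
  have : {q : ℝ × Config k | ∀ i, spaceTimePoint q.1 q.2 i ∈ s i} =
      (s (Sum.inl ())) ×ˢ {x : Config k | ∀ b, x b ∈ s (Sum.inr b)} := by
    ext q
    simp only [Set.mem_ofPred_eq, Set.mem_prod, Sum.forall, spaceTimePoint, Sum.elim_inl,
      Sum.elim_inr]
    exact and_congr_left fun _ => ⟨fun h => h (), fun h _ => h⟩
  rw [this, Measure.volume_eq_prod, Measure.prod_prod,
    volume_toLp_preimage_pi _ (fun _ => hs _)]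
  simp

/-- The configuration on which the one-particle vector `v` sits at `(s, j)`. -/
def embedParticle {k : ℕ} (s : Bool) (j : Fin k) (v : Plane) : Config k :=
  WithLp.toLp 2 fun b => if b.1 = s ∧ b.2.1 = j then v b.2.2 else 0

theorem particle_add {n : ℕ} (s : Bool) (i : Fin n) (z w : Config n) :
    particle s i (z + w) = particle s i z + particle s i w := by
  ext a; simp [particle]

theorem particle_embedParticle {k : ℕ} (s s' : Bool) (j i : Fin k) (v : Plane) :
    particle s' i (embedParticle s j v) = if s' = s ∧ i = j then v else 0 := by
  ext a
  by_cases h : s' = s ∧ i = j <;> simp [particle, embedParticle, h]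

theorem continuous_particle {n : ℕ} (s : Bool) (i : Fin n) :
    Continuous (particle s i : Config n → Plane) := by
  unfold particle; fun_prop

theorem continuous_firstParticles (k p : ℕ) : Continuous (firstParticles k p) := by
  unfold firstParticles; fun_prop

theorem continuous_embedParticle {k : ℕ} (s : Bool) (j : Fin k) :
    Continuous (embedParticle s j) := by
  unfold embedParticle
  refine (PiLp.continuous_toLp 2 _).comp (continuous_pi fun b => ?_)
  split_ifs <;> fun_prop

theorem continuous_spaceTimePoint (k : ℕ) :
    Continuous fun q : ℝ × Config k => spaceTimePoint q.1 q.2 := by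
  unfold spaceTimePoint
  refine (PiLp.continuous_toLp 2 _).comp (continuous_pi fun b => ?_)
  rcases b with u | b
  · exact continuous_fst
  · simp only [Sum.elim_inr]; fun_prop

theorem measurePreserving_add_shear {X V : Type*} [MeasureSpace X] [MeasureSpace V] [AddGroup V]
    [MeasurableAdd₂ V] [SFinite (volume : Measure X)] [SigmaFinite (volume : Measure V)]
    [(volume : Measure V).IsAddRightInvariant]
    {g : X → V} (hg : Measurable g) :
    MeasurePreserving (fun q : X × V => (q.1, q.2 + g q.1)) volume volume :=
  (MeasurePreserving.id volume).skew_product (by fun_prop)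
    (Eventually.of_forall fun x => map_add_right_eq_self volume (g x))

section Reflection

variable {ι : Type*} [Fintype ι] [DecidableEq ι]

/-- Among vectors `yᵢ` and `ζ - ∑ yᵢ` with sum `ζ`, exchange the last one with `yⱼ`. -/
def exchangeWithRemainder (ζ : Plane) (j : ι) (y : ι → Plane) : ι → Plane :=
  Function.update y j (ζ - ∑ i, y i)

theorem sum_exchangeWithRemainder (ζ : Plane) (j : ι) (y : ι → Plane) :
    ∑ i, exchangeWithRemainder ζ j y i = ζ - y j := by
  unfold exchangeWithRemainder
  rw [Finset.sum_update_of_mem (Finset.mem_univ j), ← Finset.add_sum_erase _ _ (Finset.mem_univ j),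
    ← Finset.erase_eq]
  abel

/-- The linear part (ζ = 0) is an involution, so its determinant is ±1; the general map is this
followed by a translation of the j-th slot by ζ. -/
theorem measurePreserving_exchangeWithRemainder (ζ : Plane) (j : ι) :
    MeasurePreserving (exchangeWithRemainder ζ j) volume volume := by
  let T : (ι → Plane) →ₗ[ℝ] (ι → Plane) :=
    { toFun := exchangeWithRemainder 0 j
      map_add' := by
        intro x y
        ext i a
        by_cases h : i = j
        · subst h
          simp [exchangeWithRemainder, Finset.sum_add_distrib]
          ring
        · simp [exchangeWithRemainder, h]
      map_smul' := by
        intro c x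
        ext i a
        by_cases h : i = j
        · subst h
          simp [exchangeWithRemainder, ← Finset.smul_sum]
        · simp [exchangeWithRemainder, h] }
  have hTT : T ∘ₗ T = LinearMap.id := by
    ext1 i
    ext1 v
    ext1 l
    change exchangeWithRemainder 0 j (exchangeWithRemainder 0 j _) l = _
    rw [exchangeWithRemainder, sum_exchangeWithRemainder]
    by_cases h : l = j
    · subst h; simp
    · simp [h, exchangeWithRemainder]
  have hdet : LinearMap.det T * LinearMap.det T = 1 := by
    rw [← LinearMap.det_comp, hTT, LinearMap.det_id]
  have habs : |(LinearMap.det T)⁻¹| = 1 := by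
    rcases mul_self_eq_one_iff.1 hdet with h | h <;> simp [h]
  have hT : MeasurePreserving T volume volume := by
    refine ⟨T.continuous_of_finiteDimensional.measurable, ?_⟩
    rw [Measure.map_linearMap_addHaar_eq_smul_addHaar volume (left_ne_zero_of_mul_eq_one hdet),
      habs]
    simp
  have hadd := (measurePreserving_add_right (volume : Measure (ι → Plane))
    (Pi.single j ζ)).comp hT
  convert hadd using 1
  funext y
  funext i
  by_cases h : i = j
  · subst h
    simp [T, exchangeWithRemainder, sub_eq_neg_add]
  · simp [T, exchangeWithRemainder, h]

end Reflection

/-! ### Product integrals and Japanese-bracket weights -/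

theorem lintegral_fintype_prod_eq_prod {ι : Type*} [Fintype ι] {X : ι → Type*}
    [∀ i, MeasureSpace (X i)] [∀ i, SigmaFinite (volume : Measure (X i))]
    {f : ∀ i, X i → ℝ≥0∞} (hf : ∀ i, Measurable (f i)) :
    ∫⁻ y : ∀ i, X i, ∏ i, f i (y i) = ∏ i, ∫⁻ v, f i v := by
  classical
  rcases isEmpty_or_nonempty (∀ i, X i) with h | ⟨⟨x⟩⟩
  · rw [lintegral_of_isEmpty]
    obtain ⟨i, hi⟩ : ∃ i, IsEmpty (X i) := by
      by_contra! hc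
      exact h.false fun i => (hc i).some
    rw [Finset.prod_eq_zero (Finset.mem_univ i)]
    exact lintegral_of_isEmpty _ _
  · have hm : Measurable fun y : ∀ i, X i => ∏ i, f i (y i) :=
      Finset.measurable_prod _ fun i _ => (hf i).comp (measurable_pi_apply i)
    -- Integrating out only the variables in s leaves the other factors evaluated at x; the claim is
    -- the case where s is everything.
    have key : ∀ (s : Finset ι) (x : ∀ i, X i),
        (∫⋯∫⁻_s, fun y => ∏ i, f i (y i) ∂fun _ => volume) x =
          (∏ i ∈ s, ∫⁻ v, f i v) * ∏ i ∈ sᶜ, f i (x i) := by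
      intro s
      induction s using Finset.induction_on with
      | empty => intro x; simp
      | insert a s ha ih =>
        intro x
        rw [lmarginal_insert _ hm ha]
        simp_rw [ih]
        have hc : sᶜ = insert a (insert a s)ᶜ := by
          ext i; by_cases h : i = a <;> simp [h, ha]
        have : ∀ v, ∏ i ∈ sᶜ, f i (Function.update x a v i) =
            f a v * ∏ i ∈ (insert a s)ᶜ, f i (x i) := by
          intro v
          rw [hc, Finset.prod_insert (by simp)]
          simp only [Function.update_self]
          congr 1
          refine Finset.prod_congr rfl fun i hi => ?_
          rw [Function.update_of_ne]
          rintro rfl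
          simp at hi
        simp_rw [this]
        rw [lintegral_const_mul _ ((hf a).mul_const _), lintegral_mul_const _ (hf a),
          Finset.prod_insert ha]
        ring
    rw [volume_pi, lintegral_eq_lmarginal_univ x, key]
    simp

/-- The square `1 + 4π²|v|²` of the Japanese bracket. -/
def japaneseSq (v : Plane) : ℝ := 1 + (2 * Real.pi) ^ 2 * ‖v‖ ^ 2

theorem one_le_japaneseSq (v : Plane) : 1 ≤ japaneseSq v := by
  unfold japaneseSq; nlinarith [mul_nonneg (sq_nonneg (2 * Real.pi)) (sq_nonneg ‖v‖)]

theorem japaneseSq_pos (v : Plane) : 0 < japaneseSq v := one_pos.trans_le (one_le_japaneseSq v)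

theorem continuous_japaneseSq : Continuous japaneseSq := by unfold japaneseSq; fun_prop

theorem one_le_two_pi_sq : (1 : ℝ) ≤ (2 * Real.pi) ^ 2 := by
  nlinarith [Real.pi_gt_three]

/-- The weight `⟨v⟩^{-2r}`. -/
def bracketWeight (r : ℝ) (v : Plane) : ℝ≥0∞ := ENNReal.ofReal (japaneseSq v ^ (-r))

theorem measurable_bracketWeight (r : ℝ) : Measurable (bracketWeight r) := by
  unfold bracketWeight
  exact ENNReal.measurable_ofReal.comp (continuous_japaneseSq.measurable.pow_const _)

theorem bracketWeight_rpow (r q : ℝ) (v : Plane) :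
    bracketWeight r v ^ q = bracketWeight (r * q) v := by
  unfold bracketWeight
  rw [ENNReal.ofReal_rpow_of_pos (Real.rpow_pos_of_pos (japaneseSq_pos v) _),
    ← Real.rpow_mul (japaneseSq_pos v).le]
  ring_nf

theorem lintegral_bracketWeight_lt_top {r : ℝ} (hr : 1 < r) :
    ∫⁻ v, bracketWeight r v < ∞ := by
  have h := integrable_rpow_neg_one_add_norm_sq (E := Plane) (μ := volume) (r := 2 * r)
    (by simp; linarith)
  refine lt_of_le_of_lt ?_ h.lintegral_lt_top
  refine lintegral_mono fun v => ENNReal.ofReal_le_ofReal ?_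
  rw [show -(2 * r) / 2 = -r by ring]
  refine Real.rpow_le_rpow_of_nonpos (by positivity) ?_ (by linarith)
  unfold japaneseSq
  nlinarith [one_le_two_pi_sq, sq_nonneg ‖v‖]

theorem lintegral_one_add_sq_rpow_lt_top {r : ℝ} (hr : 1 < 2 * r) :
    ∫⁻ t : ℝ, ENNReal.ofReal ((1 + (2 * Real.pi) ^ 2 * t ^ 2) ^ (-r)) < ∞ := by
  have h := integrable_rpow_neg_one_add_norm_sq (E := ℝ) (μ := volume) (r := 2 * r)
    (by simpa using hr)
  refine lt_of_le_of_lt ?_ h.lintegral_lt_top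
  refine lintegral_mono fun v => ENNReal.ofReal_le_ofReal ?_
  rw [show -(2 * r) / 2 = -r by ring]
  refine Real.rpow_le_rpow_of_nonpos (by positivity) ?_ (by linarith)
  simp only [Real.norm_eq_abs, sq_abs]
  nlinarith [one_le_two_pi_sq, sq_nonneg v]

/-! ### Uniform bounds for integrals with a singular factor in the remainder ζ - ∑ yᵢ -/

/-- Since the factor of y_j is absent, exchanging y_j with the remainder makes the argument of K an
independent variable, and the integral factorises. -/
theorem lintegral_remainder_mul_prod_ne {κ : Type*} [Fintype κ] [DecidableEq κ]
    {K f : Plane → ℝ≥0∞} (hK : Measurable K) (hf : Measurable f) (ζ : Plane) (j : κ) :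
    ∫⁻ y : κ → Plane, K (ζ - ∑ i, y i) * ∏ i ∈ Finset.univ.erase j, f (y i) =
      (∫⁻ v, K v) * (∫⁻ v, f v) ^ (Fintype.card κ - 1) := by
  have hm : Measurable fun y : κ → Plane => ∏ i, (if i = j then K else f) (y i) := by
    refine Finset.measurable_prod _ fun i _ => ?_
    split_ifs
    exacts [hK.comp (measurable_pi_apply i), hf.comp (measurable_pi_apply i)]
  have h := (measurePreserving_exchangeWithRemainder ζ j).lintegral_comp hm
  rw [lintegral_fintype_prod_eq_prod (X := fun _ : κ => Plane)
    (f := fun i => if i = j then K else f) (fun i => by split_ifs <;> assumption)] at h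
  rw [← Finset.mul_prod_erase _ _ (Finset.mem_univ j)] at h
  have e1 : ∏ i ∈ Finset.univ.erase j, ∫⁻ v, (if i = j then K else f) v =
      (∫⁻ v, f v) ^ (Fintype.card κ - 1) := by
    rw [Finset.prod_congr rfl (g := fun _ => ∫⁻ v, f v)]
    · simp [Finset.card_erase_of_mem]
    · intro i hi
      simp [Finset.ne_of_mem_erase hi]
  rw [e1, if_pos rfl] at h
  rw [← h]
  refine lintegral_congr fun y => ?_
  rw [← Finset.mul_prod_erase _ _ (Finset.mem_univ j)]
  simp only [if_pos]
  congr 1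
  · simp [exchangeWithRemainder]
  · refine Finset.prod_congr rfl fun i hi => ?_
    simp [Finset.ne_of_mem_erase hi, exchangeWithRemainder]

/-- A Young-type inequality with K in L^{1/b} and f in L^P, P = 1/(1 - b/n). The integrand is a
geometric mean of n + 1 products, each omitting one of the n + 1 functions. Each such product has an
explicitly computable integral independent of ζ, and Hölder's inequality gives the bound. -/
theorem lintegral_remainder_mul_prod_le {κ : Type*} [Fintype κ] [DecidableEq κ] [Nonempty κ]
    {K f : Plane → ℝ≥0∞} (hK : Measurable K) (hf : Measurable f) {b : ℝ} (hb0 : 0 < b)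
    (hb1 : b < 1) (ζ : Plane) :
    ∫⁻ y : κ → Plane, K (ζ - ∑ i, y i) * ∏ i, f (y i) ≤
      ((∫⁻ v, f v ^ (1 / (1 - b / Fintype.card κ))) ^ Fintype.card κ) ^ (1 - b) *
        ∏ _j : κ, ((∫⁻ v, K v ^ (1 / b)) *
          (∫⁻ v, f v ^ (1 / (1 - b / Fintype.card κ))) ^ (Fintype.card κ - 1)) ^
            (b / Fintype.card κ) := by
  set n := Fintype.card κ with hn
  have hn1 : 1 ≤ n := Fintype.card_pos
  have hnr : (1 : ℝ) ≤ n := by exact_mod_cast hn1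
  have hbn : b / n < 1 := (div_lt_one (by linarith)).2 (by linarith)
  have hbn0 : 0 < b / n := by positivity
  set P := 1 / (1 - b / n) with hP
  have hP0 : 0 < P := one_div_pos.2 (by linarith)
  -- `none` omits K and has Hölder weight 1 - b; `some j` omits f(y_j) and has weight b/n.
  let g : Option κ → (κ → Plane) → ℝ≥0∞ := fun o y =>
    o.elim (∏ i, f (y i) ^ P)
      fun j => K (ζ - ∑ i, y i) ^ (1 / b) * ∏ i ∈ Finset.univ.erase j, f (y i) ^ P
  let θ : Option κ → ℝ := fun o => o.elim (1 - b) fun _ => b / n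
  have hfm : ∀ i, Measurable fun y : κ → Plane => f (y i) ^ P := fun i =>
    (hf.comp (measurable_pi_apply i)).pow_const _
  have hKm : Measurable fun y : κ → Plane => K (ζ - ∑ i, y i) ^ (1 / b) :=
    (hK.comp (by fun_prop)).pow_const _
  have hg : ∀ o ∈ (Finset.univ : Finset (Option κ)), AEMeasurable (g o) volume := by
    rintro (_ | j) -
    · exact (Finset.measurable_prod _ fun i _ => hfm i).aemeasurable
    · exact (hKm.mul (Finset.measurable_prod _ fun i _ => hfm i)).aemeasurable
  have hθ1 : ∑ o, θ o = 1 := by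
    simp only [Fintype.sum_option, θ, Option.elim, Finset.sum_const, Finset.card_univ, ← hn,
      nsmul_eq_mul]
    field_simp
    ring
  have hθ0 : ∀ o ∈ (Finset.univ : Finset (Option κ)), 0 ≤ θ o := by
    rintro (_ | j) -
    · simp only [θ, Option.elim]; linarith
    · exact hbn0.le
  have H := ENNReal.lintegral_prod_norm_pow_le Finset.univ hg hθ1 hθ0
  have hpt : ∀ y : κ → Plane, ∏ o, g o y ^ θ o = K (ζ - ∑ i, y i) * ∏ i, f (y i) := by
    intro y
    simp only [Fintype.prod_option, g, θ, Option.elim]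
    have e1 : ∀ j : κ, (K (ζ - ∑ i, y i) ^ (1 / b) *
        ∏ i ∈ Finset.univ.erase j, f (y i) ^ P) ^ (b / n) =
        K (ζ - ∑ i, y i) ^ (1 / n : ℝ) *
          ∏ i ∈ Finset.univ.erase j, f (y i) ^ (P * (b / n)) := by
      intro j
      rw [ENNReal.mul_rpow_of_nonneg _ _ hbn0.le, ← ENNReal.rpow_mul,
        ← ENNReal.prod_rpow_of_nonneg hbn0.le]
      simp_rw [ENNReal.rpow_mul]
      rw [← ENNReal.rpow_mul]
      congr 2
      field_simp
    have e2 : ∏ j : κ, ∏ i ∈ Finset.univ.erase j, f (y i) ^ (P * (b / n)) =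
        ∏ i, f (y i) ^ (P * (b / n) * (n - 1)) := by
      have : ∀ j : κ, ∏ i ∈ Finset.univ.erase j, f (y i) ^ (P * (b / n)) =
          ∏ i, if i = j then 1 else f (y i) ^ (P * (b / n)) := by
        intro j
        rw [← Finset.mul_prod_erase Finset.univ _ (Finset.mem_univ j), if_pos rfl, one_mul]
        exact Finset.prod_congr rfl fun i hi => by rw [if_neg (Finset.ne_of_mem_erase hi)]
      simp_rw [this]
      rw [Finset.prod_comm]
      refine Finset.prod_congr rfl fun i _ => ?_
      rw [← Finset.mul_prod_erase Finset.univ _ (Finset.mem_univ i), if_pos rfl, one_mul,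
        Finset.prod_congr rfl (g := fun _ => f (y i) ^ (P * (b / n)))]
      · rw [Finset.prod_const, Finset.card_erase_of_mem (Finset.mem_univ i), Finset.card_univ,
          ← hn, ENNReal.rpow_mul _ (P * (b / n)), ← ENNReal.rpow_natCast]
        congr 1
        push_cast [hn1]
        ring
      · intro j hj
        rw [if_neg (Finset.ne_of_mem_erase hj).symm]
    simp_rw [e1]
    rw [Finset.prod_mul_distrib, e2, Finset.prod_const, Finset.card_univ, ← hn,
      ← ENNReal.rpow_natCast, ← ENNReal.rpow_mul, one_div_mul_cancel (by positivity),
      ENNReal.rpow_one, mul_left_comm, ← ENNReal.prod_rpow_of_nonneg (by linarith),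
      ← Finset.prod_mul_distrib]
    congr 1
    refine Finset.prod_congr rfl fun i _ => ?_
    rw [← ENNReal.rpow_mul, ← ENNReal.rpow_add_of_nonneg]
    · have : P * (1 - b) + P * (b / n) * (n - 1) = 1 := by
        rw [hP]
        have h1 : (n : ℝ) - b ≠ 0 := by linarith
        have h2 : 1 - b / n = (n - b) / n := by field_simp
        rw [h2]
        field_simp
        ring
      rw [this, ENNReal.rpow_one]
    · exact mul_nonneg hP0.le (by linarith)
    · exact mul_nonneg (by positivity) (by linarith)
  simp_rw [hpt] at H
  refine H.trans (le_of_eq ?_)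
  simp only [Fintype.prod_option, g, θ, Option.elim]
  congr 1
  · rw [lintegral_fintype_prod_eq_prod (X := fun _ : κ => Plane) (f := fun _ v => f v ^ P)
      (fun _ => hf.pow_const _)]
    simp [hn]
  · refine Finset.prod_congr rfl fun j _ => ?_
    rw [lintegral_remainder_mul_prod_ne (K := fun v => K v ^ (1 / b)) (f := fun v => f v ^ P)
      (hK.pow_const _) (hf.pow_const _)]

theorem exists_lintegral_remainder_mul_prod_le {κ : Type*} [Fintype κ] [Nonempty κ]
    {K f : Plane → ℝ≥0∞} (hK : Measurable K) (hf : Measurable f) {b : ℝ} (hb0 : 0 < b)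
    (hb1 : b < 1) (hKi : ∫⁻ v, K v ^ (1 / b) < ∞)
    (hfi : ∫⁻ v, f v ^ (1 / (1 - b / Fintype.card κ)) < ∞) :
    ∃ C : ℝ≥0∞, C ≠ ∞ ∧ ∀ ζ : Plane,
      ∫⁻ y : κ → Plane, K (ζ - ∑ i, y i) * ∏ i, f (y i) ≤ C := by
  classical
  refine ⟨_, ?_, fun ζ => lintegral_remainder_mul_prod_le hK hf hb0 hb1 ζ⟩
  refine ENNReal.mul_ne_top ?_ (ENNReal.prod_ne_top fun j _ => ?_)
  · exact ENNReal.rpow_ne_top_of_nonneg (by linarith) (ENNReal.pow_ne_top hfi.ne)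
  · exact ENNReal.rpow_ne_top_of_nonneg (by positivity)
      (ENNReal.mul_ne_top hKi.ne (ENNReal.pow_ne_top hfi.ne))

/-- In polar coordinates the integrand is r · r^{-3/2} = r^{-1/2}, integrable at 0. Any exponent
below 2 would do; 3/2 is the reciprocal of the Hölder parameter b = 2/3 used for this piece. -/
theorem lintegral_ball_inv_enorm_rpow_lt_top :
    ∫⁻ v : Plane, ((Metric.ball (0 : Plane) 1).indicator (fun v => ‖v‖ₑ⁻¹) v) ^ (3 / 2 : ℝ) < ∞ := by
  have h : Integrable (fun v : Plane => (Set.Iio (1 : ℝ)).indicator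
      (fun r : ℝ => r ^ (-(3 / 2) : ℝ)) ‖v‖) volume := by
    rw [integrable_fun_norm_addHaar]
    have h1 := (intervalIntegral.integrableOn_Ioo_rpow_iff (s := -(1 / 2)) one_pos).2 (by norm_num)
    rw [← integrable_indicator_iff measurableSet_Ioi]
    rw [← integrable_indicator_iff measurableSet_Ioo] at h1
    refine h1.congr (Eventually.of_forall fun r => ?_)
    by_cases h0 : 0 < r <;> by_cases h2 : r < 1 <;> simp [h0, h2]
    rw [show (-2⁻¹ : ℝ) = 1 + -(3 / 2) by norm_num, Real.rpow_add h0, Real.rpow_one]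
  refine lt_of_le_of_lt ?_ h.lintegral_lt_top
  refine lintegral_mono_ae ?_
  have hne : ∀ᵐ v : Plane, v ≠ 0 := by simp [ae_iff]
  filter_upwards [hne] with v hv
  by_cases h1 : ‖v‖ < 1
  · rw [Set.indicator_of_mem (by simpa using h1), Set.indicator_of_mem (by simpa using h1)]
    rw [← ofReal_norm, ← ENNReal.ofReal_inv_of_pos (norm_pos_iff.2 hv),
      ENNReal.ofReal_rpow_of_pos (by positivity), Real.inv_rpow (norm_nonneg _),
      Real.rpow_neg (norm_nonneg _)]
  · rw [Set.indicator_of_notMem (by simpa using h1)]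
    simp

theorem inv_enorm_le (v : Plane) : ‖v‖ₑ⁻¹ ≤
    (Metric.ball (0 : Plane) 1).indicator (fun v => ‖v‖ₑ⁻¹) v +
      ENNReal.ofReal (1 + (2 * Real.pi) ^ 2) * bracketWeight (1 / 2) v := by
  by_cases h1 : ‖v‖ < 1
  · rw [Set.indicator_of_mem (by simpa using h1)]
    exact le_self_add
  · rw [Set.indicator_of_notMem (by simpa using h1), zero_add]
    push Not at h1
    have hv : 0 < ‖v‖ := by linarith
    rw [← ofReal_norm, ← ENNReal.ofReal_inv_of_pos hv, bracketWeight,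
      ← ENNReal.ofReal_mul (by positivity)]
    refine ENNReal.ofReal_le_ofReal ?_
    rw [Real.rpow_neg (japaneseSq_pos v).le, ← Real.sqrt_eq_rpow, ← div_eq_mul_inv, inv_eq_one_div,
      div_le_div_iff₀ hv (Real.sqrt_pos.2 (japaneseSq_pos v)), one_mul]
    refine Real.sqrt_le_iff.2 ⟨by positivity, ?_⟩
    unfold japaneseSq
    have : 1 ≤ (2 * Real.pi) ^ 2 := one_le_two_pi_sq
    have h2 : 1 ≤ ‖v‖ ^ 2 := one_le_pow₀ h1
    nlinarith [mul_nonneg (sq_nonneg (2 * Real.pi)) (sq_nonneg ‖v‖)]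

/-- No single Lebesgue exponent serves |v|⁻¹ both at 0 and at infinity, so by `inv_enorm_le` the
kernel is split into a local singularity and a tail of order ⟨v⟩⁻¹, and the Hölder bound is applied
with a different b for each. The weights ⟨v⟩^{-2α} have the required integrability when n(1 - α) <
b. -/
theorem exists_lintegral_inv_remainder_mul_bracketWeight_le {κ : Type*} [Fintype κ] [Nonempty κ]
    {α : ℝ} (hα : 1 - 1 / (2 * (Fintype.card κ : ℝ)) < α) (hα1 : α < 1) :
    ∃ C : ℝ≥0∞, C ≠ ∞ ∧ ∀ ζ : Plane,
      ∫⁻ y : κ → Plane, ‖ζ - ∑ i, y i‖ₑ⁻¹ * ∏ i, bracketWeight α (y i) ≤ C := by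
  set n := Fintype.card κ with hn
  have hnr : (1 : ℝ) ≤ n := by exact_mod_cast (Fintype.card_pos : 0 < Fintype.card κ)
  have hn1 : n * (1 - α) < 1 / 2 := by
    have h : 1 - α < 1 / (2 * n) := by linarith
    rw [lt_div_iff₀ (by positivity)] at h
    linarith
  have hfi : ∀ b : ℝ, n * (1 - α) < b → b < 1 →
      ∫⁻ v, bracketWeight α v ^ (1 / (1 - b / n)) < ∞ := by
    intro b hb hb1
    simp_rw [bracketWeight_rpow]
    refine lintegral_bracketWeight_lt_top ?_
    have h1 : b / n < 1 := (div_lt_one (by linarith)).2 (by linarith)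
    rw [mul_one_div, one_lt_div (by linarith)]
    have : 1 - α < b / n := by rw [lt_div_iff₀ (by linarith)]; linarith
    linarith
  have hK1m : Measurable ((Metric.ball (0 : Plane) 1).indicator fun v => ‖v‖ₑ⁻¹) :=
    (by fun_prop : Measurable fun v : Plane => ‖v‖ₑ⁻¹).indicator measurableSet_ball
  -- Near 0 the kernel needs 1/b < 2, that is b > 1/2; b = 2/3 also exceeds n(1 - α).
  obtain ⟨C1, hC1, H1⟩ := exists_lintegral_remainder_mul_prod_le (κ := κ) hK1m
    (measurable_bracketWeight α) (b := 2 / 3) (by norm_num) (by norm_num)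
    (by
      have := lintegral_ball_inv_enorm_rpow_lt_top
      norm_num at this ⊢
      exact this)
    (hfi _ (by linarith) (by norm_num))
  -- The tail needs 1/b > 2, that is b < 1/2, while the weights need b > n(1 - α). The lower bound
  -- on α says exactly that such b exist.
  obtain ⟨b, hb, hb2⟩ := exists_between hn1
  have hb0 : 0 < b := lt_of_le_of_lt (mul_nonneg (by linarith) (by linarith)) hb
  have hK2m : Measurable fun v => ENNReal.ofReal (1 + (2 * Real.pi) ^ 2) * bracketWeight (1 / 2) v :=
    (measurable_bracketWeight _).const_mul _
  obtain ⟨C2, hC2, H2⟩ := exists_lintegral_remainder_mul_prod_le (κ := κ) hK2m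
    (measurable_bracketWeight α) hb0 (by linarith)
    (by
      have hb' : 0 ≤ 1 / b := by positivity
      simp_rw [ENNReal.mul_rpow_of_nonneg _ _ hb', bracketWeight_rpow]
      rw [lintegral_const_mul _ (measurable_bracketWeight _)]
      refine ENNReal.mul_lt_top (ENNReal.rpow_lt_top_of_nonneg hb' ENNReal.ofReal_ne_top)
        (lintegral_bracketWeight_lt_top ?_)
      rw [mul_one_div, one_lt_div hb0]
      exact hb2)
    (hfi _ hb (by linarith))
  refine ⟨C1 + C2, ENNReal.add_ne_top.2 ⟨hC1, hC2⟩, fun ζ => ?_⟩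
  refine le_trans ?_ (add_le_add (H1 ζ) (H2 ζ))
  have hsub : Measurable fun y : κ → Plane => ζ - ∑ i, y i := by fun_prop
  have hm : Measurable fun y : κ → Plane =>
      (Metric.ball (0 : Plane) 1).indicator (fun v => ‖v‖ₑ⁻¹) (ζ - ∑ i, y i) *
        ∏ i, bracketWeight α (y i) :=
    (hK1m.comp hsub).mul (Finset.measurable_prod _ fun i _ =>
      (measurable_bracketWeight α).comp (measurable_pi_apply i))
  rw [← lintegral_add_left hm]
  refine lintegral_mono fun y => ?_
  rw [← add_mul]
  gcongr
  exact inv_enorm_le _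

/-! ### The collision integral: integrating out the phase -/

theorem lintegral_comp_add_mul {G : ℝ → ℝ≥0∞} (hG : Measurable G) (c : ℝ) {b : ℝ} (hb : b ≠ 0) :
    ∫⁻ x, G (c + b * x) = ENNReal.ofReal |b⁻¹| * ∫⁻ x, G x := by
  rw [← lintegral_add_left_eq_self G c, ← smul_eq_mul, ← lintegral_smul_measure,
    ← Real.map_volume_mul_left hb, lintegral_map (by fun_prop) (by fun_prop)]

theorem lintegral_plane_eq {F : Plane → ℝ≥0∞} (hF : Measurable F) :
    ∫⁻ v, F v = ∫⁻ a : ℝ, ∫⁻ b : ℝ, F !₂[a, b] := by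
  have h := (PiLp.volume_preserving_toLp (Fin 2)).comp
    ((volume_preserving_finTwoArrow ℝ).symm)
  rw [← h.lintegral_comp hF, Measure.volume_eq_prod, lintegral_prod]
  · rfl
  · exact (hF.comp h.measurable).aemeasurable

theorem lintegral_plane_eq_swap {F : Plane → ℝ≥0∞} (hF : Measurable F) :
    ∫⁻ v, F v = ∫⁻ b : ℝ, ∫⁻ a : ℝ, F !₂[a, b] := by
  rw [lintegral_plane_eq hF, lintegral_lintegral_swap]
  have : Measurable fun q : ℝ × ℝ => (!₂[q.1, q.2] : Plane) := by
    rw [measurable_euclidean_iff]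
    intro i
    fin_cases i
    exacts [measurable_fst, measurable_snd]
  exact (hF.comp this).aemeasurable

/-- Integrate first in the coordinate direction where B is larger: the substitution costs at most
2/|B|. The weight is bounded by its value in the other coordinate alone, whose integral over the
line is finite because 2α > 1. -/
theorem exists_lintegral_bracketWeight_mul_comp_inner_le {α : ℝ} (hα : 1 / 2 < α) :
    ∃ C : ℝ≥0∞, C ≠ ∞ ∧ ∀ (B : Plane), B ≠ 0 → ∀ (c : ℝ) (G : ℝ → ℝ≥0∞), Measurable G →
      ∫⁻ v, bracketWeight α v * G (c + inner ℝ B v) ≤ C * ‖B‖ₑ⁻¹ * ∫⁻ t, G t := by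
  set I := ∫⁻ t : ℝ, ENNReal.ofReal ((1 + (2 * Real.pi) ^ 2 * t ^ 2) ^ (-α)) with hI
  have hIfin : I ≠ ∞ := (lintegral_one_add_sq_rpow_lt_top (by linarith)).ne
  have hwm : Measurable fun t : ℝ => ENNReal.ofReal ((1 + (2 * Real.pi) ^ 2 * t ^ 2) ^ (-α)) :=
    ENNReal.measurable_ofReal.comp ((by fun_prop : Measurable fun t : ℝ =>
      1 + (2 * Real.pi) ^ 2 * t ^ 2).pow_const _)
  have hw : ∀ (v : Plane) (i : Fin 2), bracketWeight α v ≤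
      ENNReal.ofReal ((1 + (2 * Real.pi) ^ 2 * (v i) ^ 2) ^ (-α)) := by
    intro v i
    refine ENNReal.ofReal_le_ofReal (Real.rpow_le_rpow_of_nonpos (by positivity) ?_ (by linarith))
    unfold japaneseSq
    have : (v i) ^ 2 ≤ ‖v‖ ^ 2 := by
      rw [EuclideanSpace.real_norm_sq_eq]
      exact Finset.single_le_sum (f := fun i => (v i) ^ 2) (fun _ _ => sq_nonneg _)
        (Finset.mem_univ i)
    gcongr
  -- Here i is the index of the dominant coordinate of B.
  have hb : ∀ (B : Plane) (i j : Fin 2), B ≠ 0 → (∀ l, l = i ∨ l = j) → |B j| ≤ |B i| →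
      B i ≠ 0 ∧ ENNReal.ofReal |(B i)⁻¹| ≤ 2 * ‖B‖ₑ⁻¹ := by
    intro B i j hB hij hle
    have h0 : B i ≠ 0 := by
      intro h0
      rw [h0, abs_zero] at hle
      have h1 : B j = 0 := abs_nonpos_iff.1 hle
      refine hB ?_
      ext l
      rcases hij l with rfl | rfl <;> simp [h0, h1]
    refine ⟨h0, ?_⟩
    have hpos : 0 < |B i| := abs_pos.2 h0
    have hn : ‖B‖ ≤ 2 * |B i| := by
      rw [EuclideanSpace.norm_eq]
      refine Real.sqrt_le_iff.2 ⟨by positivity, ?_⟩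
      have : ∀ l, ‖B l‖ ^ 2 ≤ |B i| ^ 2 := by
        intro l
        rw [Real.norm_eq_abs]
        rcases hij l with rfl | rfl
        · exact le_rfl
        · gcongr
      rw [Fin.sum_univ_two]
      nlinarith [this 0, this 1, sq_nonneg |B i|]
    have h2 : 2 * ENNReal.ofReal ‖B‖⁻¹ = ENNReal.ofReal (2 * ‖B‖⁻¹) := by
      rw [ENNReal.ofReal_mul (by norm_num)]; simp
    rw [← ofReal_norm, ← ENNReal.ofReal_inv_of_pos (norm_pos_iff.2 hB), h2]
    refine ENNReal.ofReal_le_ofReal ?_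
    rw [abs_inv, ← div_eq_mul_inv, inv_eq_one_div, div_le_div_iff₀ hpos (norm_pos_iff.2 hB)]
    linarith
  refine ⟨I * 2, ENNReal.mul_ne_top hIfin (by simp), fun B hB c G hG => ?_⟩
  have hGm : Measurable fun v : Plane => G (c + inner ℝ B v) := hG.comp (by fun_prop)
  have hFm : Measurable fun v : Plane => bracketWeight α v * G (c + inner ℝ B v) :=
    (measurable_bracketWeight α).mul hGm
  rcases le_total |B 1| |B 0| with hle | hle
  · obtain ⟨h0, h1⟩ := hb B 0 1 hB (by intro l; fin_cases l <;> simp) hle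
    rw [lintegral_plane_eq_swap hFm]
    calc ∫⁻ b : ℝ, ∫⁻ a : ℝ, bracketWeight α !₂[a, b] * G (c + inner ℝ B !₂[a, b])
        ≤ ∫⁻ b : ℝ, ∫⁻ a : ℝ, ENNReal.ofReal ((1 + (2 * Real.pi) ^ 2 * b ^ 2) ^ (-α)) *
            G ((c + B 1 * b) + B 0 * a) := by
          refine lintegral_mono fun b => lintegral_mono fun a => ?_
          refine mul_le_mul' (by simpa using hw !₂[a, b] 1) (le_of_eq ?_)
          congr 1
          simp [PiLp.inner_apply, Fin.sum_univ_two]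
          ring
      _ = ∫⁻ b : ℝ, ENNReal.ofReal ((1 + (2 * Real.pi) ^ 2 * b ^ 2) ^ (-α)) *
            (ENNReal.ofReal |(B 0)⁻¹| * ∫⁻ t, G t) := by
          refine lintegral_congr fun b => ?_
          rw [lintegral_const_mul _ (by fun_prop), lintegral_comp_add_mul hG _ h0]
      _ = I * (ENNReal.ofReal |(B 0)⁻¹| * ∫⁻ t, G t) := by
          rw [lintegral_mul_const _ hwm]
      _ ≤ I * (2 * ‖B‖ₑ⁻¹ * ∫⁻ t, G t) := by gcongr
      _ = I * 2 * ‖B‖ₑ⁻¹ * ∫⁻ t, G t := by ring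
  · obtain ⟨h0, h1⟩ := hb B 1 0 hB (by intro l; fin_cases l <;> simp) hle
    rw [lintegral_plane_eq hFm]
    calc ∫⁻ a : ℝ, ∫⁻ b : ℝ, bracketWeight α !₂[a, b] * G (c + inner ℝ B !₂[a, b])
        ≤ ∫⁻ a : ℝ, ∫⁻ b : ℝ, ENNReal.ofReal ((1 + (2 * Real.pi) ^ 2 * a ^ 2) ^ (-α)) *
            G ((c + B 0 * a) + B 1 * b) := by
          refine lintegral_mono fun a => lintegral_mono fun b => ?_
          refine mul_le_mul' (by simpa using hw !₂[a, b] 0) (le_of_eq ?_)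
          congr 1
          simp [PiLp.inner_apply, Fin.sum_univ_two]
          ring
      _ = ∫⁻ a : ℝ, ENNReal.ofReal ((1 + (2 * Real.pi) ^ 2 * a ^ 2) ^ (-α)) *
            (ENNReal.ofReal |(B 1)⁻¹| * ∫⁻ t, G t) := by
          refine lintegral_congr fun b => ?_
          rw [lintegral_const_mul _ (by fun_prop), lintegral_comp_add_mul hG _ h0]
      _ = I * (ENNReal.ofReal |(B 1)⁻¹| * ∫⁻ t, G t) := by
          rw [lintegral_mul_const _ hwm]
      _ ≤ I * (2 * ‖B‖ₑ⁻¹ * ∫⁻ t, G t) := by gcongr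
      _ = I * 2 * ‖B‖ₑ⁻¹ * ∫⁻ t, G t := by ring

section Split

variable {ι : Type*} [Fintype ι] [DecidableEq ι]

/-- The family equal to `v` at `i₁` and to `y` elsewhere. -/
def insertAt (i₁ : ι) (v : Plane) (y : {i // i ≠ i₁} → Plane) (i : ι) : Plane :=
  if h : i ≠ i₁ then y ⟨i, h⟩ else v

theorem measurePreserving_insertAt (i₁ : ι) :
    MeasurePreserving (fun q : ({i // i ≠ i₁} → Plane) × Plane => insertAt i₁ q.2 q.1)
      volume volume := by
  let _ : Unique {i // ¬ i ≠ i₁} := ⟨⟨⟨i₁, by simp⟩⟩, fun x => Subtype.ext (not_not.1 x.2)⟩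
  have h1 := (volume_preserving_piEquivPiSubtypeProd (fun _ : ι => Plane) (fun i => i ≠ i₁)).symm
  have h2 : MeasurePreserving (Prod.map id 
      (MeasurableEquiv.piUnique fun _ : {i // ¬ i ≠ i₁} => Plane).symm)
      (volume : Measure (({i // i ≠ i₁} → Plane) × Plane)) volume :=
    (MeasurePreserving.id volume).prod (volume_preserving_piUnique fun _ : {i // ¬ i ≠ i₁} => Plane).symm
  exact h1.comp h2

theorem prod_insertAt {M : Type*} [CommMonoid M] (i₁ : ι) (v : Plane) (y : {i // i ≠ i₁} → Plane)
    (f : ι → Plane → M) :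
    ∏ i, f i (insertAt i₁ v y i) = f i₁ v * ∏ i : {i // i ≠ i₁}, f i (y i) := by
  rw [Fintype.prod_eq_mul_prod_subtype_ne _ i₁]
  congr 1
  · simp [insertAt]
  · refine Finset.prod_congr rfl fun i _ => ?_
    simp [insertAt, i.2]

theorem sum_insertAt {M : Type*} [AddCommMonoid M] (i₁ : ι) (v : Plane)
    (y : {i // i ≠ i₁} → Plane) (f : ι → Plane → M) :
    ∑ i, f i (insertAt i₁ v y i) = f i₁ v + ∑ i : {i // i ≠ i₁}, f i (y i) :=
  prod_insertAt (M := Multiplicative M) i₁ v y f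

end Split

/-- Exchanging one variable with the remainder reduces this to the nullity of {y_j = 0}. It discards
the points where the phase below has zero gradient. -/
theorem ae_remainder_ne_zero {κ : Type*} [Fintype κ] [Nonempty κ] (ζ : Plane) :
    ∀ᵐ y : κ → Plane, ζ - ∑ i, y i ≠ 0 := by
  classical
  obtain ⟨j⟩ := ‹Nonempty κ›
  have h0 : (volume : Measure (κ → Plane)) {y | y j = 0} = 0 := by
    rw [volume_pi]; exact Measure.pi_hyperplane _ j 0
  have hm : MeasurableSet {y : κ → Plane | y j = 0} :=
    measurable_pi_apply j (measurableSet_singleton 0)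
  have h := (measurePreserving_exchangeWithRemainder ζ j).measure_preimage hm.nullMeasurableSet
  rw [h0] at h
  rw [ae_iff]
  convert h using 2
  ext y
  simp [exchangeWithRemainder]

/-- The sign condition at i₁ makes |y_{i₁}|² cancel against the square in the remainder, so the
phase is affine in y_{i₁}. Integrating that variable gives the inverse length of the gradient, and
the remaining variables are handled by `exists_lintegral_inv_remainder_mul_bracketWeight_le`; this
is why the threshold for α involves one variable fewer. -/
theorem exists_lintegral_prod_bracketWeight_mul_comp_phase_le {ι : Type*} [Fintype ι]
    [DecidableEq ι] {α : ℝ} (hι : 2 ≤ Fintype.card ι)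
    (hα : 1 - 1 / (2 * ((Fintype.card ι - 1 : ℕ) : ℝ)) < α) (hα1 : α < 1) :
    ∃ C : ℝ≥0∞, C ≠ ∞ ∧ ∀ (i₁ : ι) (e : ι → ℝ) (e₀ : ℝ), |e₀| = 1 → e i₁ = -e₀ →
      ∀ (ζ : Plane) (c : ℝ) (G : ℝ → ℝ≥0∞), Measurable G →
      ∫⁻ y : ι → Plane, (∏ i, bracketWeight α (y i)) *
        G (c - 2 * Real.pi * (e₀ * ‖ζ - ∑ i, y i‖ ^ 2 + ∑ i, e i * ‖y i‖ ^ 2)) ≤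
        C * ∫⁻ t, G t := by
  have hcr : (1 : ℝ) ≤ ((Fintype.card ι - 1 : ℕ) : ℝ) := by
    exact_mod_cast (by omega : 1 ≤ Fintype.card ι - 1)
  have hα2 : 1 / 2 < α := by
    have : 1 / (2 * ((Fintype.card ι - 1 : ℕ) : ℝ)) ≤ 1 / 2 := by
      apply one_div_le_one_div_of_le <;> linarith
    linarith
  have hcard : ∀ i₁ : ι, Fintype.card {i // i ≠ i₁} = Fintype.card ι - 1 := by
    intro i₁; simp [Fintype.card_subtype_compl]
  have hne : ∀ i₁ : ι, Nonempty {i // i ≠ i₁} := by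
    intro i₁
    rw [← Fintype.card_pos_iff, hcard]; omega
  obtain ⟨C1, hC1, H1⟩ := exists_lintegral_bracketWeight_mul_comp_inner_le hα2
  have h2 : ∀ i₁ : ι, ∃ C : ℝ≥0∞, C ≠ ∞ ∧ ∀ ζ : Plane, ∫⁻ y : {i // i ≠ i₁} → Plane,
      ‖ζ - ∑ i, y i‖ₑ⁻¹ * ∏ i, bracketWeight α (y i) ≤ C := by
    intro i₁
    have := hne i₁
    exact exists_lintegral_inv_remainder_mul_bracketWeight_le (by rw [hcard]; exact hα) hα1
  choose C2 hC2 H2 using h2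
  refine ⟨C1 * ∑ i, C2 i, ENNReal.mul_ne_top hC1 (ENNReal.sum_ne_top.2 fun i _ => hC2 i), ?_⟩
  intro i₁ e e₀ he₀ he ζ c G hG
  have := hne i₁
  have hFm : Measurable fun y : ι → Plane => (∏ i, bracketWeight α (y i)) *
      G (c - 2 * Real.pi * (e₀ * ‖ζ - ∑ i, y i‖ ^ 2 + ∑ i, e i * ‖y i‖ ^ 2)) :=
    (Finset.measurable_prod _ fun i _ => (measurable_bracketWeight α).comp
      (measurable_pi_apply i)).mul (hG.comp (by fun_prop))
  have hmp := measurePreserving_insertAt i₁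
  have hprod := lintegral_prod (μ := (volume : Measure ({i // i ≠ i₁} → Plane)))
    (ν := (volume : Measure Plane)) _ (hFm.comp hmp.measurable).aemeasurable
  simp only [Function.comp_def] at hprod
  rw [← hmp.lintegral_comp hFm, Measure.volume_eq_prod, hprod]
  have hae : ∀ᵐ y : {i // i ≠ i₁} → Plane,
      ∫⁻ v, (∏ i, bracketWeight α (insertAt i₁ v y i)) *
        G (c - 2 * Real.pi * (e₀ * ‖ζ - ∑ i, insertAt i₁ v y i‖ ^ 2 +
          ∑ i, e i * ‖insertAt i₁ v y i‖ ^ 2)) ≤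
      (‖ζ - ∑ i, y i‖ₑ⁻¹ * ∏ i, bracketWeight α (y i)) * (C1 * ∫⁻ t, G t) := by
    filter_upwards [ae_remainder_ne_zero ζ] with y hy
    set A := ζ - ∑ i, y i with hA
    -- The gradient of the phase in v: the expression -2π(e₀|A - v|² - e₀|v|²) equals a constant
    -- plus 4πe₀⟨A, v⟩.
    set B : Plane := (4 * Real.pi * e₀) • A with hB
    have hnB : ‖A‖ ≤ ‖B‖ := by
      rw [hB, norm_smul, norm_mul, Real.norm_eq_abs e₀, he₀, mul_one, Real.norm_eq_abs,
        abs_of_pos (by positivity)]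
      nlinarith [Real.pi_gt_three, norm_nonneg A]
    have hB0 : B ≠ 0 := norm_pos_iff.1 ((norm_pos_iff.2 hy).trans_le hnB)
    set c' := c - 2 * Real.pi * (e₀ * ‖A‖ ^ 2 + ∑ i : {i // i ≠ i₁}, e i * ‖y i‖ ^ 2) with hc'
    have harg : ∀ v, c - 2 * Real.pi * (e₀ * ‖ζ - ∑ i, insertAt i₁ v y i‖ ^ 2 +
          ∑ i, e i * ‖insertAt i₁ v y i‖ ^ 2) = c' + inner ℝ B v := by
      intro v
      rw [sum_insertAt i₁ v y (fun i w => e i * ‖w‖ ^ 2), sum_insertAt i₁ v y (fun _ w => w), he,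
        show ζ - (v + ∑ i : {i // i ≠ i₁}, y i) = A - v by rw [hA]; abel, norm_sub_sq_real, hB,
        real_inner_smul_left, hc']
      ring
    simp_rw [harg, prod_insertAt i₁ _ y (fun _ w => bracketWeight α w)]
    calc ∫⁻ v, bracketWeight α v * (∏ i : {i // i ≠ i₁}, bracketWeight α (y i)) *
          G (c' + inner ℝ B v)
        = ∫⁻ v, (∏ i : {i // i ≠ i₁}, bracketWeight α (y i)) *
          (bracketWeight α v * G (c' + inner ℝ B v)) := by
          refine lintegral_congr fun v => ?_
          ring
      _ = (∏ i : {i // i ≠ i₁}, bracketWeight α (y i)) *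
          ∫⁻ v, bracketWeight α v * G (c' + inner ℝ B v) :=
          lintegral_const_mul _ ((measurable_bracketWeight α).mul (hG.comp (by fun_prop)))
      _ ≤ (∏ i : {i // i ≠ i₁}, bracketWeight α (y i)) * (C1 * ‖B‖ₑ⁻¹ * ∫⁻ t, G t) := by
          gcongr; exact H1 B hB0 c' G hG
      _ ≤ (∏ i : {i // i ≠ i₁}, bracketWeight α (y i)) * (C1 * ‖A‖ₑ⁻¹ * ∫⁻ t, G t) := by
          gcongr
          rw [← ofReal_norm, ← ofReal_norm]
          exact ENNReal.ofReal_le_ofReal hnB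
      _ = _ := by ring
  refine (lintegral_mono_ae hae).trans ?_
  have hm2 : Measurable fun y : {i // i ≠ i₁} → Plane =>
      ‖ζ - ∑ i, y i‖ₑ⁻¹ * ∏ i, bracketWeight α (y i) :=
    (by fun_prop : Measurable fun y : {i // i ≠ i₁} → Plane => ‖ζ - ∑ i, y i‖ₑ⁻¹).mul
      (Finset.measurable_prod _ fun i _ => (measurable_bracketWeight α).comp
        (measurable_pi_apply i))
  rw [lintegral_mul_const _ hm2]
  calc _ ≤ C2 i₁ * (C1 * ∫⁻ t, G t) := by gcongr; exact H2 i₁ ζ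
    _ ≤ (∑ i, C2 i) * (C1 * ∫⁻ t, G t) := by
        gcongr; exact Finset.single_le_sum (fun _ _ => zero_le) (Finset.mem_univ i₁)
    _ = _ := by ring

/-- The sign of the Laplacian in the evolution equation: `1` for `x`, `-1` for `x'`. -/
def particleSign (s : Bool) : ℝ := if s then -1 else 1

@[simp]
theorem abs_particleSign (s : Bool) : |particleSign s| = 1 := by cases s <;> simp [particleSign]

theorem particleSign_not (s : Bool) : particleSign (!s) = -particleSign s := by
  cases s <;> simp [particleSign]

/-- Some w m has norm at least |ζ|/N, so its weight absorbs ⟨ζ⟩^{2α} up to the factor N^{2α}.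
Summing over m avoids choosing m measurably. -/
theorem japaneseSq_rpow_mul_prod_bracketWeight_le {ι : Type*} [Fintype ι] [DecidableEq ι] {α : ℝ}
    (hα0 : 0 ≤ α) (w : ι → Plane) (ζ : Plane) (hw : ∑ i, w i = ζ) (hι : 0 < Fintype.card ι) :
    ENNReal.ofReal (japaneseSq ζ ^ α) * ∏ i, bracketWeight α (w i) ≤
      ENNReal.ofReal (((Fintype.card ι : ℝ) ^ 2) ^ α) *
        ∑ m, ∏ i ∈ Finset.univ.erase m, bracketWeight α (w i) := by
  set N := Fintype.card ι with hN
  have hN1 : (1 : ℝ) ≤ N := by exact_mod_cast hι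
  obtain ⟨m, -, hm⟩ : ∃ m ∈ (Finset.univ : Finset ι), ‖ζ‖ / N ≤ ‖w m‖ := by
    refine Finset.exists_le_of_sum_le ?_ ?_
    · rw [Finset.univ_nonempty_iff]; exact Fintype.card_pos_iff.1 hι
    · rw [Finset.sum_const, Finset.card_univ, ← hN, nsmul_eq_mul,
        mul_div_cancel₀ _ (by positivity), ← hw]
      exact norm_sum_le _ _
  have hζ : ‖ζ‖ ≤ N * ‖w m‖ := by rw [div_le_iff₀ (by positivity)] at hm; linarith
  have hJ : japaneseSq ζ ≤ (N : ℝ) ^ 2 * japaneseSq (w m) := by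
    unfold japaneseSq
    have h1 : ‖ζ‖ ^ 2 ≤ (N * ‖w m‖) ^ 2 := by gcongr
    have h2 : (1 : ℝ) ≤ (N : ℝ) ^ 2 := one_le_pow₀ hN1
    nlinarith [mul_le_mul_of_nonneg_left h1 (sq_nonneg (2 * Real.pi))]
  have hb : ENNReal.ofReal (japaneseSq ζ ^ α) * bracketWeight α (w m) ≤
      ENNReal.ofReal (((N : ℝ) ^ 2) ^ α) := by
    unfold bracketWeight
    rw [← ENNReal.ofReal_mul (Real.rpow_nonneg (japaneseSq_pos _).le _)]
    refine ENNReal.ofReal_le_ofReal ?_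
    rw [Real.rpow_neg (japaneseSq_pos _).le, ← div_eq_mul_inv,
      div_le_iff₀ (Real.rpow_pos_of_pos (japaneseSq_pos _) _),
      ← Real.mul_rpow (by positivity) (japaneseSq_pos _).le]
    exact Real.rpow_le_rpow (japaneseSq_pos _).le hJ hα0
  rw [← Finset.mul_prod_erase _ _ (Finset.mem_univ m), ← mul_assoc]
  refine mul_le_mul' hb ?_
  exact Finset.single_le_sum (f := fun m => ∏ i ∈ Finset.univ.erase m, bracketWeight α (w i))
    (fun _ _ => zero_le) (Finset.mem_univ m)

/-- After ⟨ζ⟩^{2α} is absorbed, each term lacks the weight of one of the 2p + 1 frequencies. That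
frequency is made the remainder, and the phase lemma applies because, as p ≥ 1, a variable of the
opposite sign is always left. -/
theorem exists_lintegral_collision_le (p : ℕ) (hp : 1 ≤ p) {α : ℝ}
    (hα : 1 - 1 / (2 * (2 * (p : ℝ) - 1)) < α) (hα1 : α < 1) :
    ∃ C : ℝ≥0∞, C ≠ ∞ ∧ ∀ (s : Bool) (ζ : Plane) (c : ℝ) (G : ℝ → ℝ≥0∞), Measurable G →
      ∫⁻ y : Bool × Fin p → Plane, ENNReal.ofReal (japaneseSq ζ ^ α) *
        (bracketWeight α (ζ - ∑ b, y b) * ∏ b, bracketWeight α (y b)) *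
        G (c - 2 * Real.pi * (particleSign s * ‖ζ - ∑ b, y b‖ ^ 2 +
          ∑ b, particleSign b.1 * ‖y b‖ ^ 2)) ≤ C * ∫⁻ t, G t := by
  have hpr : (1 : ℝ) ≤ p := by exact_mod_cast hp
  have hcard : Fintype.card (Bool × Fin p) = 2 * p := by simp
  have hα0 : 0 ≤ α := by
    have : 1 / (2 * (2 * (p : ℝ) - 1)) ≤ 1 := by
      rw [div_le_one (by linarith)]; linarith
    linarith
  obtain ⟨C, hC, H⟩ := exists_lintegral_prod_bracketWeight_mul_comp_phase_le
    (ι := Bool × Fin p) (α := α) (by omega) (by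
      rw [hcard, Nat.cast_sub (by omega)]
      push_cast
      exact hα) hα1
  set N := Fintype.card (Option (Bool × Fin p)) with hN
  refine ⟨ENNReal.ofReal (((N : ℝ) ^ 2) ^ α) * (N * C),
    ENNReal.mul_ne_top ENNReal.ofReal_ne_top (ENNReal.mul_ne_top (by simp) hC), ?_⟩
  intro s ζ c G hG
  let w : (Bool × Fin p → Plane) → Option (Bool × Fin p) → Plane :=
    fun y o => o.elim (ζ - ∑ b, y b) y
  let Ph : (Bool × Fin p → Plane) → ℝ := fun y => c - 2 * Real.pi *
    (particleSign s * ‖ζ - ∑ b, y b‖ ^ 2 + ∑ b, particleSign b.1 * ‖y b‖ ^ 2)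
  have hPh : Measurable fun y => G (Ph y) := hG.comp (by fun_prop)
  have hwm : ∀ o, Measurable fun y => bracketWeight α (w y o) := by
    intro o
    refine (measurable_bracketWeight α).comp ?_
    cases o
    · simp only [w, Option.elim]; fun_prop
    · exact measurable_pi_apply _
  have hterm : ∀ m, ∫⁻ y, (∏ o ∈ Finset.univ.erase m, bracketWeight α (w y o)) * G (Ph y) ≤
      C * ∫⁻ t, G t := by
    rintro (_ | j)
    -- The missing weight is already that of the remainder, whose sign is that of s.
    · have h := H (!s, ⟨0, hp⟩) (fun b => particleSign b.1) (particleSign s) (abs_particleSign s)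
        (particleSign_not s) ζ c G hG
      refine le_trans (le_of_eq (lintegral_congr fun y => ?_)) h
      congr 1
      have : (Finset.univ.erase none : Finset (Option (Bool × Fin p))) =
          Finset.univ.map Function.Embedding.some := by
        ext o; cases o <;> simp
      rw [this, Finset.prod_map]
      rfl
    -- The missing weight is that of y_j. After y_j and the remainder are exchanged, slot j carries
    -- the sign of s and the remainder the sign of j, so the cancelling variable is taken of the
    -- type opposite to j, hence different from j.
    · set e : Bool × Fin p → ℝ := Function.update (fun b => particleSign b.1) j (particleSign s)
        with he
      have hj : ((!j.1, ⟨0, hp⟩) : Bool × Fin p) ≠ j := by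
        intro h; have := congrArg Prod.fst h; simp at this
      have h := H (!j.1, ⟨0, hp⟩) e (particleSign j.1) (abs_particleSign _)
        (by rw [he, Function.update_of_ne hj]; exact particleSign_not _) ζ c G hG
      have hmp := measurePreserving_exchangeWithRemainder ζ j
      have hFm : Measurable fun y : Bool × Fin p → Plane => (∏ i, bracketWeight α (y i)) *
          G (c - 2 * Real.pi * (particleSign j.1 * ‖ζ - ∑ i, y i‖ ^ 2 + ∑ i, e i * ‖y i‖ ^ 2)) :=
        (Finset.measurable_prod _ fun i _ => (measurable_bracketWeight α).comp
          (measurable_pi_apply i)).mul (hG.comp (by fun_prop))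
      rw [← hmp.lintegral_comp hFm] at h
      refine le_trans (le_of_eq (lintegral_congr fun y => ?_)) h
      have hne : ∀ i, i ≠ j → exchangeWithRemainder ζ j y i = y i := fun i hi => by
        simp [exchangeWithRemainder, hi]
      have hself : exchangeWithRemainder ζ j y j = ζ - ∑ b, y b := by simp [exchangeWithRemainder]
      congr 1
      · have : (Finset.univ.erase (some j) : Finset (Option (Bool × Fin p))) =
            insert none ((Finset.univ.erase j).map Function.Embedding.some) := by
          ext o; cases o <;> simp
        rw [this, Finset.prod_insert (by simp), Finset.prod_map,
          ← Finset.mul_prod_erase Finset.univ _ (Finset.mem_univ j), hself]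
        simp only [w, Option.elim, Function.Embedding.some_apply]
        congr 1
        exact Finset.prod_congr rfl fun i hi => by rw [hne i (Finset.ne_of_mem_erase hi)]
      · congr 2
        have hsum : ∑ i ∈ Finset.univ.erase j, e i * ‖exchangeWithRemainder ζ j y i‖ ^ 2 =
            ∑ i ∈ Finset.univ.erase j, particleSign i.1 * ‖y i‖ ^ 2 := by
          refine Finset.sum_congr rfl fun i hi => ?_
          rw [hne i (Finset.ne_of_mem_erase hi), he,
            Function.update_of_ne (Finset.ne_of_mem_erase hi)]
        have hej : e j = particleSign s := by simp [he]
        simp only [Ph]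
        rw [sum_exchangeWithRemainder, sub_sub_cancel,
          ← Finset.add_sum_erase Finset.univ (fun i => e i * _) (Finset.mem_univ j),
          ← Finset.add_sum_erase Finset.univ (fun i : Bool × Fin p => particleSign i.1 * ‖y i‖ ^ 2)
            (Finset.mem_univ j), hself, hsum, hej]
        ring
  calc _ ≤ ∫⁻ y, ENNReal.ofReal (((N : ℝ) ^ 2) ^ α) *
        ∑ m, (∏ o ∈ Finset.univ.erase m, bracketWeight α (w y o)) * G (Ph y) := by
        refine lintegral_mono fun y => ?_
        rw [← Finset.sum_mul, ← mul_assoc (ENNReal.ofReal (((N : ℝ) ^ 2) ^ α))]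
        refine mul_le_mul' ?_ le_rfl
        have := japaneseSq_rpow_mul_prod_bracketWeight_le hα0 (w y) ζ (by simp [w]) (by simp)
        simpa [w, hN] using this
    _ = ENNReal.ofReal (((N : ℝ) ^ 2) ^ α) *
        ∑ m, ∫⁻ y, (∏ o ∈ Finset.univ.erase m, bracketWeight α (w y o)) * G (Ph y) := by
        have hm : ∀ m, Measurable fun y =>
            (∏ o ∈ Finset.univ.erase m, bracketWeight α (w y o)) * G (Ph y) := fun m =>
          (Finset.measurable_prod _ fun o _ => hwm o).mul hPh
        rw [lintegral_const_mul _ (Finset.measurable_sum _ fun m _ => hm m),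
          lintegral_finsetSum _ fun m _ => hm m]
    _ ≤ ENNReal.ofReal (((N : ℝ) ^ 2) ^ α) * ∑ m : Option (Bool × Fin p), C * ∫⁻ t, G t := by
        gcongr with m _
        exact hterm m
    _ = _ := by
        rw [Finset.sum_const, Finset.card_univ, ← hN, nsmul_eq_mul]
        ring

/-! ### Frequencies of the contraction and the weighted density bound -/

/-- The frequency dual to time: the free evolution multiplies by `exp(2πi t ω(ξ))`. -/
def freeFrequency {n : ℕ} (ξ : Config n) : ℝ :=
  -(2 * Real.pi) * ∑ s, ∑ i, particleSign s * ‖particle s i ξ‖ ^ 2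

/-- The sum of the frequencies of the particles that are contracted. -/
def contractedSum (k p : ℕ) (ξ : Config (k + p)) : Plane :=
  ∑ b : Bool × Fin p, particle b.1 (Fin.natAdd k b.2) ξ

/-- The spatial frequency of the contraction. -/
def contractFrequency {k p : ℕ} (s : Bool) (j : Fin k) (ξ : Config (k + p)) : Config k :=
  firstParticles k p ξ + embedParticle s j (contractedSum k p ξ)

/-- The space-time frequency of the contraction of a free solution. -/
def contractPoint {k p : ℕ} (s : Bool) (j : Fin k) (ξ : Config (k + p)) : SpaceTime k :=
  spaceTimePoint (freeFrequency ξ) (contractFrequency s j ξ)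

theorem continuous_freeFrequency {n : ℕ} : Continuous (freeFrequency : Config n → ℝ) := by
  unfold freeFrequency
  refine continuous_const.mul (continuous_finsetSum _ fun s _ => continuous_finsetSum _ fun i _ =>
    continuous_const.mul ((continuous_particle s i).norm.pow 2))

theorem continuous_contractFrequency {k p : ℕ} (s : Bool) (j : Fin k) :
    Continuous (contractFrequency s j : Config (k + p) → Config k) := by
  unfold contractFrequency contractedSum
  exact (continuous_firstParticles k p).add ((continuous_embedParticle s j).comp
    (continuous_finsetSum _ fun b _ => continuous_particle _ _))

theorem continuous_contractPoint {k p : ℕ} (s : Bool) (j : Fin k) :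
    Continuous (contractPoint s j : Config (k + p) → SpaceTime k) :=
  (continuous_spaceTimePoint k).comp
    (continuous_freeFrequency.prodMk (continuous_contractFrequency s j))

/-- Coordinates adapted to the contraction: the contracted particles and the frequency of the
contraction. -/
def shearConfig {k p : ℕ} (s : Bool) (j : Fin k) (q : (Bool × Fin p → Plane) × Config k) :
    Config (k + p) :=
  joinConfig k p (q.1, q.2 + embedParticle s j (-∑ b, q.1 b))

theorem measurePreserving_shearConfig {k p : ℕ} (s : Bool) (j : Fin k) :
    MeasurePreserving (shearConfig s j : (Bool × Fin p → Plane) × Config k → Config (k + p))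
      volume volume :=
  (measurePreserving_joinConfig k p).comp (measurePreserving_add_shear
    (g := fun y : Bool × Fin p → Plane => embedParticle s j (-∑ b, y b))
    ((continuous_embedParticle s j).comp (by fun_prop)).measurable)

@[simp]
theorem contractedSum_shearConfig {k p : ℕ} (s : Bool) (j : Fin k)
    (q : (Bool × Fin p → Plane) × Config k) :
    contractedSum k p (shearConfig s j q) = ∑ b, q.1 b := by
  simp [contractedSum, shearConfig]

@[simp]
theorem contractFrequency_shearConfig {k p : ℕ} (s : Bool) (j : Fin k)
    (q : (Bool × Fin p → Plane) × Config k) :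
    contractFrequency s j (shearConfig s j q) = q.2 := by
  unfold contractFrequency
  rw [contractedSum_shearConfig, shearConfig, firstParticles_joinConfig]
  ext b
  by_cases h : b.1 = s ∧ b.2.1 = j <;> simp [embedParticle, h]

/-- The shear changes only slot (s, j) among the first k, so all other factors agree. Stated in a
commutative monoid, without division, so that it yields both the quotient of the symbols (a product)
and the phase (a sum, through `Multiplicative`). -/
theorem prod_shearConfig {M : Type*} [CommMonoid M] {k p : ℕ} (s : Bool) (j : Fin k)
    (q : (Bool × Fin p → Plane) × Config k) (g : Bool → Plane → M) :
    (∏ s', ∏ i, g s' (particle s' i (shearConfig s j q))) * g s (particle s j q.2) =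
      (∏ s', ∏ i, g s' (particle s' i q.2)) *
        (g s (particle s j q.2 - ∑ b, q.1 b) * ∏ b, g b.1 (q.1 b)) := by
  simp only [shearConfig, Fin.prod_univ_add, particle_castAdd_joinConfig,
    particle_natAdd_joinConfig, Finset.prod_mul_distrib, particle_add, particle_embedParticle]
  simp only [← Fintype.prod_prod_type' (f := fun s' i => g s' (particle s' i q.2)),
    ← Fintype.prod_prod_type' (f := fun s' i => g s' (q.1 (s', i))),
    ← Fintype.prod_prod_type' (f := fun s' i => g s' (particle s' i q.2 +
      if s' = s ∧ i = j then -∑ b, q.1 b else 0))]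
  rw [← Finset.mul_prod_erase Finset.univ _ (Finset.mem_univ (s, j)),
    ← Finset.mul_prod_erase Finset.univ (fun x : Bool × Fin k => g x.1 (particle x.1 x.2 q.2))
      (Finset.mem_univ (s, j))]
  have : ∏ x ∈ Finset.univ.erase (s, j), g x.1 (particle x.1 x.2 q.2 +
      if x.1 = s ∧ x.2 = j then -∑ b, q.1 b else 0) =
      ∏ x ∈ Finset.univ.erase (s, j), g x.1 (particle x.1 x.2 q.2) := by
    refine Finset.prod_congr rfl fun x hx => ?_
    rw [if_neg, add_zero]
    rintro ⟨h1, h2⟩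
    exact Finset.ne_of_mem_erase hx (Prod.ext h1 h2)
  rw [this]
  simp only [and_self, if_true, ← sub_eq_add_neg]
  ac_rfl

theorem sobolevSymbol_eq_prod {n : ℕ} (α : ℝ) (ξ : Config n) :
    sobolevSymbol α ξ = ∏ s, ∏ i, japaneseSq (particle s i ξ) ^ (α / 2) := rfl

theorem sobolevSymbol_pos {n : ℕ} (α : ℝ) (ξ : Config n) : 0 < sobolevSymbol α ξ := by
  rw [sobolevSymbol_eq_prod]
  exact Finset.prod_pos fun s _ => Finset.prod_pos fun i _ =>
    Real.rpow_pos_of_pos (japaneseSq_pos _) _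

theorem continuous_sobolevSymbol {n : ℕ} (α : ℝ) :
    Continuous (sobolevSymbol α : Config n → ℝ) := by
  unfold sobolevSymbol
  refine continuous_finsetProd _ fun s _ => continuous_finsetProd _ fun i _ => ?_
  refine Continuous.rpow_const (by
    have := continuous_particle (n := n) s i
    fun_prop) fun ξ => Or.inl ?_
  exact (japaneseSq_pos _).ne'

/-- The shear makes the spatial frequency x of the contraction one of the coordinates. For fixed x
the inner integral is a collision integral with ζ the (s, j) component of x; its bound is the
integral of F over the time frequency, and integrating over x concludes. -/
theorem exists_lintegral_contractPoint_le (p : ℕ) (hp : 1 ≤ p) {α : ℝ}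
    (hα : 1 - 1 / (2 * (2 * (p : ℝ) - 1)) < α) (hα1 : α < 1) :
    ∃ C : ℝ≥0∞, C ≠ ∞ ∧ ∀ (k : ℕ) (s : Bool) (j : Fin k) (F : SpaceTime k → ℝ≥0∞), Measurable F →
      ∫⁻ ξ : Config (k + p), ENNReal.ofReal
        ((sobolevSymbol α (contractFrequency s j ξ) / sobolevSymbol α ξ) ^ 2) *
          F (contractPoint s j ξ) ≤ C * ∫⁻ w, F w := by
  obtain ⟨C, hC, H⟩ := exists_lintegral_collision_le p hp hα hα1
  refine ⟨C, hC, fun k s j F hF => ?_⟩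
  have hm : Measurable fun ξ : Config (k + p) => ENNReal.ofReal
      ((sobolevSymbol α (contractFrequency s j ξ) / sobolevSymbol α ξ) ^ 2) *
        F (contractPoint s j ξ) := by
    refine Measurable.mul (ENNReal.measurable_ofReal.comp ?_)
      (hF.comp (continuous_contractPoint s j).measurable)
    exact ((((continuous_sobolevSymbol α).comp (continuous_contractFrequency s j)).div
      (continuous_sobolevSymbol α) fun ξ => (sobolevSymbol_pos α ξ).ne').pow 2).measurable
  have hmp := measurePreserving_shearConfig (p := p) s j
  have hprod := lintegral_prod_symm (μ := (volume : Measure (Bool × Fin p → Plane)))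
    (ν := (volume : Measure (Config k))) _ (hm.comp hmp.measurable).aemeasurable
  simp only [Function.comp_def] at hprod
  rw [← hmp.lintegral_comp hm, Measure.volume_eq_prod, hprod,
    ← (measurePreserving_spaceTimePoint k).lintegral_comp hF, Measure.volume_eq_prod]
  have hF' : AEMeasurable (fun q : ℝ × Config k => F (spaceTimePoint q.1 q.2))
      ((volume : Measure ℝ).prod (volume : Measure (Config k))) :=
    (hF.comp (measurable_spaceTimePoint k)).aemeasurable
  rw [lintegral_prod_symm _ hF', ← lintegral_const_mul']
  swap
  · exact hC
  refine lintegral_mono fun x => ?_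
  set ζ := particle s j x with hζ
  -- The added term removes the contribution of ζ from ω(x), since in the fibre that slot holds ζ -
  -- ∑ y_b instead.
  have h := H s ζ (freeFrequency x + 2 * Real.pi * (particleSign s * ‖ζ‖ ^ 2))
    (fun t => F (spaceTimePoint t x)) (hF.comp ((measurable_spaceTimePoint k).comp
      (measurable_id.prodMk measurable_const)))
  refine le_trans (lintegral_mono fun y => ?_) h
  dsimp only
  rw [contractPoint, contractFrequency_shearConfig]
  refine mul_le_mul' (le_of_eq ?_) (le_of_eq ?_)
  · have e := prod_shearConfig s j (y, x) (fun _ v => japaneseSq v ^ (α / 2))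
    simp only [← sobolevSymbol_eq_prod, ← hζ] at e
    unfold bracketWeight
    rw [← ENNReal.ofReal_prod_of_nonneg fun b _ => Real.rpow_nonneg (japaneseSq_pos _).le _,
      ← ENNReal.ofReal_mul (Real.rpow_nonneg (japaneseSq_pos _).le _),
      ← ENNReal.ofReal_mul (Real.rpow_nonneg (japaneseSq_pos _).le _)]
    congr 1
    have hsq : ∀ v, japaneseSq v ^ α = (japaneseSq v ^ (α / 2)) ^ 2 := by
      intro v
      rw [← Real.rpow_natCast, ← Real.rpow_mul (japaneseSq_pos v).le]
      norm_num
    simp only [Real.rpow_neg (japaneseSq_pos _).le, hsq]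
    rw [Finset.prod_inv_distrib, Finset.prod_pow, ← mul_inv, ← mul_pow, ← inv_pow, ← mul_pow]
    congr 1
    have hpos1 := Real.rpow_pos_of_pos (japaneseSq_pos (ζ - ∑ b, y b)) (α / 2)
    have hpos2 : 0 < ∏ b, japaneseSq (y b) ^ (α / 2) :=
      Finset.prod_pos fun b _ => Real.rpow_pos_of_pos (japaneseSq_pos _) _
    rw [← div_eq_mul_inv, div_eq_div_iff (sobolevSymbol_pos _ _).ne' (mul_pos hpos1 hpos2).ne']
    linarith
  · congr 2
    have e := prod_shearConfig (M := Multiplicative ℝ) s j (y, x)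
      (fun s' v => Multiplicative.ofAdd (particleSign s' * ‖v‖ ^ 2))
    replace e : (∑ s', ∑ i, particleSign s' * ‖particle s' i (shearConfig s j (y, x))‖ ^ 2) +
        particleSign s * ‖ζ‖ ^ 2 = (∑ s', ∑ i, particleSign s' * ‖particle s' i x‖ ^ 2) +
        (particleSign s * ‖ζ - ∑ b, y b‖ ^ 2 + ∑ b, particleSign b.1 * ‖y b‖ ^ 2) := e
    unfold freeFrequency
    linear_combination (-(2 * Real.pi)) * e

/-! ### The bilinear pairing on L² and its compatibility with the Fourier transform -/

open FourierTransform

/-- The bilinear pairing `∫ f g` on `L²`. -/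
def l2Pairing (E : Type*) [MeasureSpace E] :
    Lp ℂ 2 (volume : Measure E) →L[ℂ] Lp ℂ 2 (volume : Measure E) →L[ℂ] ℂ :=
  (ContinuousLinearMap.mul ℂ ℂ).lpPairing volume 2 2

section Pairing

variable {E : Type*} [NormedAddCommGroup E] [InnerProductSpace ℝ E] [FiniteDimensional ℝ E]
  [MeasurableSpace E] [BorelSpace E]

theorem l2Pairing_apply (f g : Lp ℂ 2 (volume : Measure E)) :
    l2Pairing E f g = ∫ x, f x * g x := by
  simp [l2Pairing, ContinuousLinearMap.lpPairing_eq_integral]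

/-- A Schwartz function as an element of `L²`. -/
def schwartzL2 : 𝓢(E, ℂ) →L[ℂ] Lp ℂ 2 (volume : Measure E) := SchwartzMap.toLpCLM ℂ ℂ 2 volume

theorem coeFn_schwartzL2 (ψ : 𝓢(E, ℂ)) : schwartzL2 ψ =ᵐ[volume] ψ :=
  ψ.coeFn_toLp 2 volume

theorem denseRange_schwartzL2 :
    DenseRange (schwartzL2 : 𝓢(E, ℂ) → Lp ℂ 2 (volume : Measure E)) :=
  SchwartzMap.denseRange_toLpCLM (p := 2) ENNReal.ofNat_ne_top

theorem l2Pairing_schwartzL2 (ψ : 𝓢(E, ℂ)) (g : Lp ℂ 2 (volume : Measure E)) :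
    l2Pairing E (schwartzL2 ψ) g = ∫ x, ψ x * g x := by
  rw [l2Pairing_apply]
  refine integral_congr_ae ?_
  filter_upwards [coeFn_schwartzL2 ψ] with x hx
  rw [hx]

theorem l2Pairing_schwartzL2_eq_apply (ψ : 𝓢(E, ℂ)) (g : Lp ℂ 2 (volume : Measure E)) :
    l2Pairing E (schwartzL2 ψ) g = Lp.toTemperedDistribution g ψ := by
  rw [l2Pairing_schwartzL2, Lp.toTemperedDistribution_apply]
  rfl

theorem l2Pairing_schwartzL2_fourier (ψ : 𝓢(E, ℂ)) (g : Lp ℂ 2 (volume : Measure E)) :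
    l2Pairing E (schwartzL2 ψ) (𝓕 g) = l2Pairing E (schwartzL2 (𝓕 ψ)) g := by
  rw [l2Pairing_schwartzL2_eq_apply, l2Pairing_schwartzL2_eq_apply,
    ← Lp.fourier_toTemperedDistribution_eq,
    TemperedDistribution.fourier_apply]

theorem toTemperedDistribution_injective :
    Function.Injective (Lp.toTemperedDistribution :
      Lp ℂ 2 (volume : Measure E) → 𝓢'(E, ℂ)) := by
  have h := Lp.ker_toTemperedDistributionCLM_eq_bot (F := ℂ) (μ := (volume : Measure E)) (p := 2)
  rw [LinearMap.ker_eq_bot] at h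
  exact h

theorem eq_of_l2Pairing_schwartzL2_eq {f g : Lp ℂ 2 (volume : Measure E)}
    (h : ∀ ψ : 𝓢(E, ℂ), l2Pairing E (schwartzL2 ψ) f = l2Pairing E (schwartzL2 ψ) g) : f = g := by
  refine toTemperedDistribution_injective ?_
  ext ψ
  rw [← l2Pairing_schwartzL2_eq_apply, ← l2Pairing_schwartzL2_eq_apply, h]

end Pairing

/-! ### Weak solutions are given by the Fourier multiplier of the free evolution -/

/-- A product rule in which g need only be continuous and differentiable when paired with the fixed
vector Ψ t, which is all a weak solution offers. -/
theorem hasDerivAt_bilinear_of_weak {E F : Type*} [NormedAddCommGroup E] [NormedSpace ℂ E]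
    [NormedAddCommGroup F] [NormedSpace ℂ F] (B : E →L[ℂ] F →L[ℂ] ℂ) {Ψ : ℝ → E} {Ψ' : E}
    {g : ℝ → F} {t : ℝ} {D : ℂ} (hΨ : HasDerivAt Ψ Ψ' t) (hg : ContinuousAt g t)
    (hD : HasDerivAt (fun s => B (Ψ t) (g s)) D t) :
    HasDerivAt (fun s => B (Ψ s) (g s)) (B Ψ' (g t) + D) t := by
  rw [hasDerivAt_iff_tendsto_slope] at hΨ hD ⊢
  have h1 : Tendsto (fun s => B (slope Ψ t s) (g s)) (𝓝[≠] t) (𝓝 (B Ψ' (g t))) := by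
    have hB : Continuous fun q : E × F => B q.1 q.2 := B.continuous₂
    exact (hB.tendsto (Ψ', g t)).comp
      (hΨ.prodMk_nhds (hg.tendsto.mono_left nhdsWithin_le_nhds))
  refine (h1.add hD).congr fun s => ?_
  have hB : B ((s - t)⁻¹ • (Ψ s - Ψ t)) (g s) = (s - t)⁻¹ • B (Ψ s - Ψ t) (g s) := by
    rw [← Complex.coe_smul, ← Complex.coe_smul, map_smul]
    rfl
  simp only [slope_def_module, hB]
  rw [← smul_add, map_sub]
  simp

theorem hasTemperateGrowth_cexp_I_mul :
    (fun t : ℝ => Complex.exp (Complex.I * t)).HasTemperateGrowth := by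
  have hd : ∀ n : ℕ, iteratedDeriv n (fun t : ℝ => Complex.exp (Complex.I * t)) =
      fun t : ℝ => Complex.I ^ n * Complex.exp (Complex.I * t) := by
    intro n
    induction n with
    | zero => simp
    | succ n ih =>
      rw [iteratedDeriv_succ, ih]
      funext t
      have h := (((hasDerivAt_id (t : ℂ)).const_mul Complex.I).cexp.comp_ofReal).const_mul
        (Complex.I ^ n)
      simp only [id, mul_one] at h
      rw [h.deriv]
      ring
  refine ⟨?_, fun n => ⟨0, 1, fun t => ?_⟩⟩
  · have : ContDiff ℝ ⊤ fun t : ℝ => (t : ℂ) := Complex.ofRealCLM.contDiff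
    exact ((contDiff_const.mul Complex.ofRealCLM.contDiff).cexp)
  · rw [norm_iteratedFDeriv_eq_norm_iteratedDeriv, hd]
    simp [mul_comm Complex.I, Complex.norm_exp_ofReal_mul_I]

theorem freeFrequency_eq_sum_inner {n : ℕ} (ξ : Config n) :
    freeFrequency ξ = -(2 * Real.pi) * ∑ s, ∑ i, particleSign s * ∑ a : Fin 2,
      (inner ℝ ξ (EuclideanSpace.single (s, i, a) (1 : ℝ))) ^ 2 := by
  unfold freeFrequency
  have h : ∀ b, inner ℝ ξ (EuclideanSpace.single b (1 : ℝ)) = ξ b := fun b => by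
    rw [EuclideanSpace.inner_single_right]; simp
  simp only [EuclideanSpace.real_norm_sq_eq, particle, h]

theorem hasTemperateGrowth_freeFrequency {n : ℕ} :
    (freeFrequency : Config n → ℝ).HasTemperateGrowth := by
  have : (freeFrequency : Config n → ℝ) = fun ξ => -(2 * Real.pi) * ∑ s, ∑ i, particleSign s *
      ∑ a : Fin 2, (inner ℝ ξ (EuclideanSpace.single (s, i, a) (1 : ℝ))) ^ 2 :=
    funext freeFrequency_eq_sum_inner
  rw [this]
  fun_prop

/-- The multiplier `exp(2πi t ω(ξ))` of the free evolution. -/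
def freePhase {n : ℕ} (t : ℝ) (ξ : Config n) : ℂ :=
  Complex.exp (Complex.I * (2 * Real.pi * t * freeFrequency ξ : ℝ))

@[simp]
theorem norm_freePhase {n : ℕ} (t : ℝ) (ξ : Config n) : ‖freePhase t ξ‖ = 1 := by
  rw [freePhase, mul_comm, Complex.norm_exp_ofReal_mul_I]

theorem continuous_freePhase {n : ℕ} :
    Continuous fun q : ℝ × Config n => freePhase q.1 q.2 := by
  unfold freePhase
  have := continuous_freeFrequency (n := n)
  fun_prop

theorem hasTemperateGrowth_freePhase {n : ℕ} (t : ℝ) :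
    (freePhase t : Config n → ℂ).HasTemperateGrowth := by
  have h : (fun ξ : Config n => 2 * Real.pi * t * freeFrequency ξ).HasTemperateGrowth := by
    have := hasTemperateGrowth_freeFrequency (n := n)
    fun_prop
  exact hasTemperateGrowth_cexp_I_mul.comp h

theorem hasTemperateGrowth_ofReal_freeFrequency {n : ℕ} :
    (fun ξ : Config n => (freeFrequency ξ : ℂ)).HasTemperateGrowth :=
  Function.Complex.hasTemperateGrowth_ofReal.comp hasTemperateGrowth_freeFrequency

/-- Multiplication of Schwartz functions by the multiplier of the free evolution. -/
def evolveSchwartz {n : ℕ} (t : ℝ) : 𝓢(Config n, ℂ) →L[ℂ] 𝓢(Config n, ℂ) :=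
  SchwartzMap.smulLeftCLM ℂ (freePhase t)

theorem evolveSchwartz_apply {n : ℕ} (t : ℝ) (ψ : 𝓢(Config n, ℂ)) (ξ : Config n) :
    evolveSchwartz t ψ ξ = freePhase t ξ * ψ ξ := by
  simp [evolveSchwartz, hasTemperateGrowth_freePhase]

/-- Multiplication of Schwartz functions by the frequency of the free evolution. -/
def frequencyMul {n : ℕ} : 𝓢(Config n, ℂ) →L[ℂ] 𝓢(Config n, ℂ) :=
  SchwartzMap.smulLeftCLM ℂ fun ξ => (freeFrequency ξ : ℂ)

theorem frequencyMul_apply {n : ℕ} (ψ : 𝓢(Config n, ℂ)) (ξ : Config n) :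
    frequencyMul ψ ξ = freeFrequency ξ * ψ ξ := by
  simp [frequencyMul, hasTemperateGrowth_ofReal_freeFrequency]

theorem partialLaplacian_fourier {n : ℕ} (ψ : 𝓢(Config n, ℂ)) :
    partialLaplacian false (𝓕 ψ) - partialLaplacian true (𝓕 ψ) =
      𝓕 ((2 * Real.pi : ℂ) • frequencyMul ψ) := by
  have h : ∀ s, partialLaplacian s (𝓕 ψ) = 𝓕 (∑ i : Fin n, ∑ a : Fin 2,
      (-(2 * Real.pi * Complex.I)) • SchwartzMap.smulLeftCLM ℂ
        (fun ξ : Config n => inner ℝ ξ (EuclideanSpace.single (s, i, a) (1 : ℝ)))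
        ((-(2 * Real.pi * Complex.I)) • SchwartzMap.smulLeftCLM ℂ
          (fun ξ : Config n => inner ℝ ξ (EuclideanSpace.single (s, i, a) (1 : ℝ))) ψ)) := by
    intro s
    unfold partialLaplacian
    simp only [SchwartzMap.lineDerivOp_fourier_eq]
    simp only [← fourierCLM_apply (R := ℂ), map_sum]
  rw [h, h]
  simp only [← fourierCLM_apply (R := ℂ)]
  rw [← map_sub]
  congr 1
  ext ξ
  have hg : ∀ m : Config n, (fun ξ : Config n => inner ℝ ξ m).HasTemperateGrowth := by
    intro m; fun_prop
  have hI : Complex.I * Complex.I = -1 := Complex.I_mul_I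
  simp only [sub_apply, sum_apply, smul_apply,
    SchwartzMap.smulLeftCLM_apply_apply (hg _), frequencyMul_apply, freeFrequency_eq_sum_inner,
    Fintype.sum_bool, particleSign, smul_eq_mul, Complex.real_smul]
  push_cast
  have : ∀ s : Bool, ∑ i : Fin n, ∑ a : Fin 2, -(2 * Real.pi * Complex.I) *
      ((inner ℝ ξ (EuclideanSpace.single (s, i, a) (1 : ℝ)) : ℝ) * (-(2 * Real.pi * Complex.I) *
        ((inner ℝ ξ (EuclideanSpace.single (s, i, a) (1 : ℝ)) : ℝ) * ψ ξ))) =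
      -(2 * Real.pi) ^ 2 * (∑ i : Fin n, ∑ a : Fin 2,
        ((inner ℝ ξ (EuclideanSpace.single (s, i, a) (1 : ℝ)) : ℝ) : ℂ) ^ 2) * ψ ξ := by
    intro s
    simp only [Finset.mul_sum, Finset.sum_mul]
    refine Finset.sum_congr rfl fun i _ => Finset.sum_congr rfl fun a _ => ?_
    linear_combination ((2 * Real.pi) ^ 2 *
      ((inner ℝ ξ (EuclideanSpace.single (s, i, a) (1 : ℝ)) : ℝ) : ℂ) ^ 2 * ψ ξ) * hI
  rw [this, this]
  simp only [neg_mul, one_mul, Finset.sum_neg_distrib]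
  ring

theorem norm_cexp_I_mul_sub_one_sub_le (θ : ℝ) :
    ‖Complex.exp (Complex.I * θ) - 1 - Complex.I * θ‖ ≤ 3 * θ ^ 2 := by
  have hn : ‖Complex.I * (θ : ℂ)‖ = |θ| := by simp
  rcases le_total |θ| 1 with h | h
  · refine (Complex.norm_exp_sub_one_sub_id_le (by rw [hn]; exact h)).trans ?_
    rw [hn, sq_abs]
    nlinarith [sq_nonneg θ]
  · have h1 : ‖Complex.exp (Complex.I * θ)‖ = 1 := by
      rw [mul_comm, Complex.norm_exp_ofReal_mul_I]
    calc _ ≤ ‖Complex.exp (Complex.I * θ)‖ + ‖(1 : ℂ)‖ + ‖Complex.I * (θ : ℂ)‖ :=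
          (norm_sub_le _ _).trans (add_le_add (norm_sub_le _ _) le_rfl)
      _ = 2 + |θ| := by rw [h1, hn, norm_one]; ring
      _ ≤ 3 * θ ^ 2 := by rw [← sq_abs]; nlinarith

/-- The second-order Taylor bound for the exponential holds pointwise in ξ; the factor ω² it
produces is harmless because ω²ψ is again Schwartz, so the remainder is O((s - t)²) in L². -/
theorem hasDerivAt_schwartzL2_evolveSchwartz {n : ℕ} (ψ : 𝓢(Config n, ℂ)) (t : ℝ) :
    HasDerivAt (fun s => schwartzL2 (evolveSchwartz (-s) ψ))
      ((-(2 * Real.pi * Complex.I)) • schwartzL2 (frequencyMul (evolveSchwartz (-t) ψ))) t := by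
  rw [hasDerivAt_iff_isLittleO]
  set R : 𝓢(Config n, ℂ) := ((2 * Real.pi : ℂ) ^ 2) • frequencyMul (frequencyMul ψ) with hR
  have hb : ∀ s : ℝ, ‖schwartzL2 (evolveSchwartz (-s) ψ) -
      schwartzL2 (evolveSchwartz (-t) ψ) - (s - t) • ((-(2 * Real.pi * Complex.I)) •
        schwartzL2 (frequencyMul (evolveSchwartz (-t) ψ)))‖ ≤
      3 * (s - t) ^ 2 * ‖schwartzL2 R‖ := by
    intro s
    refine Lp.norm_le_mul_norm_of_ae_le_mul ?_
    have e : schwartzL2 (evolveSchwartz (-s) ψ) - schwartzL2 (evolveSchwartz (-t) ψ) -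
        (s - t) • ((-(2 * Real.pi * Complex.I)) •
          schwartzL2 (frequencyMul (evolveSchwartz (-t) ψ))) =
        schwartzL2 (evolveSchwartz (-s) ψ - evolveSchwartz (-t) ψ - ((s - t : ℝ) : ℂ) •
          ((-(2 * Real.pi * Complex.I)) • (frequencyMul (evolveSchwartz (-t) ψ)))) := by
      rw [map_sub, map_sub, map_smul, map_smul, Complex.coe_smul]
      rfl
    rw [e]
    filter_upwards [coeFn_schwartzL2 R, coeFn_schwartzL2 (evolveSchwartz (-s) ψ -
      evolveSchwartz (-t) ψ - ((s - t : ℝ) : ℂ) •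
        ((-(2 * Real.pi * Complex.I)) • (frequencyMul (evolveSchwartz (-t) ψ))))] with ξ h1 h2
    rw [h1, h2, hR]
    simp only [sub_apply, smul_apply, evolveSchwartz_apply,
      frequencyMul_apply, smul_eq_mul]
    set θ : ℝ := 2 * Real.pi * (-(s - t)) * freeFrequency ξ with hθ
    have hs : freePhase (-s) ξ = freePhase (-t) ξ * Complex.exp (Complex.I * θ) := by
      unfold freePhase
      rw [← Complex.exp_add, hθ]
      congr 1
      push_cast
      ring
    have : freePhase (-s) ξ * ψ ξ - freePhase (-t) ξ * ψ ξ - ((s - t : ℝ) : ℂ) *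
        (-(2 * Real.pi * Complex.I) * (freeFrequency ξ * (freePhase (-t) ξ * ψ ξ))) =
        freePhase (-t) ξ * ψ ξ * (Complex.exp (Complex.I * θ) - 1 - Complex.I * θ) := by
      rw [hs, hθ]
      push_cast
      ring
    rw [this, norm_mul, norm_mul, norm_freePhase, one_mul]
    refine (mul_le_mul_of_nonneg_left (norm_cexp_I_mul_sub_one_sub_le θ) (norm_nonneg _)).trans
      (le_of_eq ?_)
    simp only [norm_mul, norm_pow, Complex.norm_real, Complex.norm_ofNat, Real.norm_eq_abs]
    rw [hθ, abs_of_pos Real.pi_pos]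
    have := sq_abs (freeFrequency ξ)
    linear_combination (-3 * (s - t) ^ 2 * (2 * Real.pi) ^ 2 * ‖ψ ξ‖) * this
  refine Asymptotics.IsBigO.trans_isLittleO (g := fun s => (s - t) ^ 2) ?_ ?_
  · refine Asymptotics.IsBigO.of_bound (3 * ‖schwartzL2 R‖)
      (Eventually.of_forall fun s => (hb s).trans (le_of_eq ?_))
    rw [Real.norm_eq_abs, abs_of_nonneg (sq_nonneg _)]
    ring
  · have h := Asymptotics.isLittleO_pow_id (𝕜 := ℝ) (n := 2) (by norm_num)
    have ht : Tendsto (fun s : ℝ => s - t) (𝓝 t) (𝓝 0) := by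
      have : Continuous fun s : ℝ => s - t := by fun_prop
      simpa using this.tendsto t
    exact h.comp_tendsto ht

theorem memLp_freePhase_mul {n : ℕ} (t : ℝ) (g : Lp ℂ 2 (volume : Measure (Config n))) :
    MemLp (fun ξ => freePhase t ξ * g ξ) 2 (volume : Measure (Config n)) := by
  refine (Lp.memLp g).of_le ?_ (Eventually.of_forall fun ξ => ?_)
  · exact (continuous_freePhase.comp (by fun_prop : Continuous fun ξ : Config n => (t, ξ))
      ).aestronglyMeasurable.mul (Lp.aestronglyMeasurable g)
  · rw [norm_mul, norm_freePhase, one_mul]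

/-- Multiplication of `L²` functions by the multiplier of the free evolution. -/
def evolveL2 {n : ℕ} (t : ℝ) (g : Lp ℂ 2 (volume : Measure (Config n))) :
    Lp ℂ 2 (volume : Measure (Config n)) :=
  (memLp_freePhase_mul t g).toLp

theorem coeFn_evolveL2 {n : ℕ} (t : ℝ) (g : Lp ℂ 2 (volume : Measure (Config n))) :
    evolveL2 t g =ᵐ[volume] fun ξ => freePhase t ξ * g ξ :=
  (memLp_freePhase_mul t g).coeFn_toLp

theorem norm_evolveL2 {n : ℕ} (t : ℝ) (g : Lp ℂ 2 (volume : Measure (Config n))) :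
    ‖evolveL2 t g‖ = ‖g‖ := by
  rw [evolveL2, Lp.norm_toLp, Lp.norm_def]
  congr 1
  refine eLpNorm_congr_norm_ae (Eventually.of_forall fun ξ => ?_)
  rw [norm_mul, norm_freePhase, one_mul]

theorem IsFreeSolution.hasDerivAt_l2Pairing {n : ℕ}
    {γ : ℝ → Lp ℂ 2 (volume : Measure (Config n))} {γ₀ : Lp ℂ 2 (volume : Measure (Config n))}
    (h : IsFreeSolution γ γ₀) (ψ : 𝓢(Config n, ℂ)) (t : ℝ) :
    HasDerivAt (fun s => l2Pairing _ (schwartzL2 ψ) (𝓕 (γ s)))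
      (2 * Real.pi * Complex.I * l2Pairing _ (schwartzL2 (frequencyMul ψ)) (𝓕 (γ t))) t := by
  obtain ⟨D, hD, hE⟩ := h.equation (𝓕 ψ) t
  have h1 : ∀ s, l2Pairing _ (schwartzL2 ψ) (𝓕 (γ s)) = ∫ z, 𝓕 ψ z * γ s z := fun s => by
    rw [l2Pairing_schwartzL2_fourier, l2Pairing_schwartzL2]
  have h2 : D = 2 * Real.pi * Complex.I *
      l2Pairing _ (schwartzL2 (frequencyMul ψ)) (𝓕 (γ t)) := by
    rw [partialLaplacian_fourier, ← l2Pairing_schwartzL2, ← l2Pairing_schwartzL2_fourier,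
      map_smul, map_smul,
      smul_apply, smul_eq_mul] at hE
    generalize l2Pairing (Config n) (schwartzL2 (frequencyMul ψ)) (𝓕 (γ t)) = X at hE ⊢
    have hI : Complex.I * Complex.I = -1 := Complex.I_mul_I
    linear_combination (-Complex.I) * hE + D * hI
  rw [← h2, funext h1]
  exact hD

/-- Paired with the test function evolved backwards, `𝓕 (γ t)` has zero time derivative, so the
pairing keeps its value at t = 0. This is uniqueness for the weak equation. -/
theorem IsFreeSolution.fourier_eq {n : ℕ}
    {γ : ℝ → Lp ℂ 2 (volume : Measure (Config n))} {γ₀ : Lp ℂ 2 (volume : Measure (Config n))}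
    (h : IsFreeSolution γ γ₀) (t : ℝ) : 𝓕 (γ t) = evolveL2 t (𝓕 γ₀) := by
  have hconst : ∀ (ψ : 𝓢(Config n, ℂ)) (t : ℝ),
      l2Pairing _ (schwartzL2 (evolveSchwartz (-t) ψ)) (𝓕 (γ t)) =
        l2Pairing _ (schwartzL2 ψ) (𝓕 γ₀) := by
    intro ψ t
    have hd : ∀ s, HasDerivAt (fun s => l2Pairing _ (schwartzL2 (evolveSchwartz (-s) ψ)) (𝓕 (γ s)))
        0 s := by
      intro s
      have hcont : Continuous fun s => 𝓕 (γ s) :=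
        (fourierCLM ℂ (Lp ℂ 2 (volume : Measure (Config n)))).continuous.comp h.continuous
      have hh := hasDerivAt_bilinear_of_weak (l2Pairing (Config n))
        (hasDerivAt_schwartzL2_evolveSchwartz ψ s) hcont.continuousAt
        (h.hasDerivAt_l2Pairing (evolveSchwartz (-s) ψ) s)
      convert hh using 1
      rw [map_smul, smul_apply, smul_eq_mul]
      ring
    have hc := is_const_of_deriv_eq_zero (fun s => (hd s).differentiableAt)
      (fun s => (hd s).deriv) t 0
    rw [hc, h.initial]
    congr 3
    ext ξ
    simp [evolveSchwartz_apply, freePhase]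
  -- Choosing as initial test function χ evolved forwards by t makes the test function at time t
  -- equal to χ.
  refine eq_of_l2Pairing_schwartzL2_eq fun χ => ?_
  have e : evolveSchwartz (-t) (evolveSchwartz t χ) = χ := by
    ext ξ
    rw [evolveSchwartz_apply, evolveSchwartz_apply, ← mul_assoc, freePhase, freePhase,
      ← Complex.exp_add]
    simp
  have := hconst (evolveSchwartz t χ) t
  rw [e] at this
  rw [this, l2Pairing_schwartzL2, l2Pairing_schwartzL2]
  refine integral_congr_ae ?_
  filter_upwards [coeFn_evolveL2 t (𝓕 γ₀)] with ξ h1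
  rw [h1, evolveSchwartz_apply]
  ring

/-! ### Parseval's identity for functions in L¹ ∩ L² -/

section Pairing

variable {E : Type*} [NormedAddCommGroup E] [InnerProductSpace ℝ E] [FiniteDimensional ℝ E]
  [MeasurableSpace E] [BorelSpace E]

theorem ae_eq_of_integral_schwartz_mul_eq {f g : E → ℂ} (hf : LocallyIntegrable f volume)
    (hg : LocallyIntegrable g volume)
    (h : ∀ ψ : 𝓢(E, ℂ), ∫ x, ψ x * f x = ∫ x, ψ x * g x) : f =ᵐ[volume] g := by
  refine ae_eq_of_integral_contDiff_smul_eq hf hg fun χ hχ hc => ?_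
  have h1 : HasCompactSupport (Complex.ofRealCLM ∘ χ) := hc.comp_left rfl
  have h2 := Complex.ofRealCLM.contDiff.comp hχ
  simpa using! h (h1.toSchwartzMap h2)

theorem l2Pairing_fourierInv (f g : Lp ℂ 2 (volume : Measure E)) :
    l2Pairing E (𝓕⁻ f) g = l2Pairing E f (𝓕⁻ g) := by
  refine denseRange_schwartzL2.induction_on
    (p := fun f => l2Pairing E (𝓕⁻ f) g = l2Pairing E f (𝓕⁻ g)) f ?_ fun ψ => ?_
  · refine isClosed_eq ?_ ?_
    · have h : Continuous fun f : Lp ℂ 2 (volume : Measure E) => 𝓕⁻ f :=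
        (fourierInvCLM ℂ (Lp ℂ 2 (volume : Measure E))).continuous
      exact ((l2Pairing E).flip g).continuous.comp h
    · exact ((l2Pairing E).flip (𝓕⁻ g)).continuous
  · have h := l2Pairing_schwartzL2_fourier (𝓕⁻ ψ) (𝓕⁻ g)
    rw [fourier_fourierInv_eq, fourier_fourierInv_eq] at h
    rw [← h]
    congr 2
    exact SchwartzMap.toLp_fourierInv_eq ψ

theorem norm_l2_fourierInv (f : Lp ℂ 2 (volume : Measure E)) : ‖𝓕⁻ f‖ = ‖f‖ := by
  conv_rhs => rw [← fourier_fourierInv_eq (F := Lp ℂ 2 (volume : Measure E)) f, Lp.norm_fourier_eq]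

theorem integral_fourierInv_mul_eq {f g : E → ℂ} (hf : Integrable f) (hg : Integrable g) :
    ∫ x, 𝓕⁻ f x * g x = ∫ x, f x * 𝓕⁻ g x := by
  have h := VectorFourier.integral_fourierIntegral_smul_eq_flip (L := -innerₗ E)
    (μ := volume) (ν := volume) Real.continuous_fourierChar continuous_inner.neg hf hg
  have e : ∀ u : E → ℂ, 𝓕⁻ u =
      VectorFourier.fourierIntegral Real.fourierChar volume (-innerₗ E) u := by
    intro u; ext w; rfl
  have hflip : (-innerₗ E).flip = -innerₗ E := by
    ext x y; simp [real_inner_comm]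
  rw [hflip] at h
  simpa only [e, smul_eq_mul] using h

theorem continuous_fourierInv {f : E → ℂ} (hf : Integrable f) : Continuous (𝓕⁻ f) :=
  VectorFourier.fourierIntegral_continuous (L := -innerₗ E) Real.continuous_fourierChar
    continuous_inner.neg hf

/-- The L² transform and the Fourier integral satisfy the same duality relation against Schwartz
functions, so they agree almost everywhere. -/
theorem coeFn_fourierInv_toLp {f : E → ℂ} (hf : Integrable f) (hf2 : MemLp f 2) :
    (𝓕⁻ hf2.toLp : Lp ℂ 2 (volume : Measure E)) =ᵐ[volume] 𝓕⁻ f := by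
  refine ae_eq_of_integral_schwartz_mul_eq
    ((Lp.memLp _).locallyIntegrable (by norm_num)) (continuous_fourierInv hf).locallyIntegrable
    fun ψ => ?_
  rw [← l2Pairing_schwartzL2, ← l2Pairing_fourierInv,
    show 𝓕⁻ (schwartzL2 ψ) = schwartzL2 (𝓕⁻ ψ) from SchwartzMap.toLp_fourierInv_eq ψ,
    l2Pairing_schwartzL2, ← integral_fourierInv_mul_eq ψ.integrable hf, SchwartzMap.fourierInv_coe]
  refine integral_congr_ae ?_
  filter_upwards [hf2.coeFn_toLp] with x hx
  rw [hx]

/-- Parseval's identity for the pairing of an integrable `L²` function with an `L²` function. -/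
theorem integral_mul_eq_integral_fourierInv_mul_fourier {f : E → ℂ} (hf : Integrable f)
    (hf2 : MemLp f 2) (g : Lp ℂ 2 (volume : Measure E)) :
    ∫ x, f x * g x = ∫ ξ, 𝓕⁻ f ξ * (𝓕 g) ξ := by
  have h := l2Pairing_fourierInv hf2.toLp (𝓕 g)
  rw [fourierInv_fourier_eq, l2Pairing_apply, l2Pairing_apply] at h
  refine Eq.trans ?_ (h.symm.trans ?_)
  · refine integral_congr_ae ?_
    filter_upwards [hf2.coeFn_toLp] with x hx
    rw [hx]
  · refine integral_congr_ae ?_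
    filter_upwards [coeFn_fourierInv_toLp hf hf2] with x hx
    rw [hx]

/-- Cauchy–Schwarz and Plancherel. -/
theorem integral_norm_fourierInv_mul_le {f : E → ℂ} (hf : Integrable f)
    (hf2 : MemLp f 2) (g : Lp ℂ 2 (volume : Measure E)) :
    Integrable (fun ξ => 𝓕⁻ f ξ * g ξ) ∧
      ∫ ξ, ‖𝓕⁻ f ξ * g ξ‖ ≤ (eLpNorm f 2 volume).toReal * ‖g‖ := by
  have h2 : MemLp (𝓕⁻ f) 2 := (memLp_congr_ae (coeFn_fourierInv_toLp hf hf2)).1 (Lp.memLp _)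
  have hn : (eLpNorm (𝓕⁻ f) 2 volume).toReal = (eLpNorm f 2 volume).toReal := by
    rw [← eLpNorm_congr_ae (coeFn_fourierInv_toLp hf hf2), ← Lp.norm_def, norm_l2_fourierInv,
      Lp.norm_toLp]
  refine ⟨h2.integrable_mul (Lp.memLp g), ?_⟩
  have hm : AEStronglyMeasurable (fun ξ => 𝓕⁻ f ξ * g ξ) := h2.1.mul (Lp.memLp g).1
  rw [← hn, Lp.norm_def, ← ENNReal.toReal_mul, integral_norm_eq_lintegral_enorm hm]
  refine ENNReal.toReal_mono (ENNReal.mul_ne_top h2.2.ne (Lp.memLp g).2.ne) ?_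
  rw [← eLpNorm_one_eq_lintegral_enorm]
  generalize 𝓕⁻ f = φ at h2 ⊢
  have hg := (Lp.memLp g).1
  generalize (g : E → ℂ) = u at hg ⊢
  have h := eLpNorm_smul_le_mul_eLpNorm (p := 2) (q := 2) (r := 1) hg h2.1
  exact h

end Pairing

/-! ### The regularised contraction in frequency variables and its limit -/

/-- Coordinates adapted to the contraction: the contracted particles, relative to the `j`-th
particle, and the remaining configuration. -/
def relativeConfig {k p : ℕ} (s : Bool) (j : Fin k) (q : (Bool × Fin p → Plane) × Config k) :
    Config (k + p) :=
  joinConfig k p (fun b => particle s j q.2 - q.1 b, q.2)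

theorem measurePreserving_relativeConfig {k p : ℕ} (s : Bool) (j : Fin k) :
    MeasurePreserving (relativeConfig s j : (Bool × Fin p → Plane) × Config k → Config (k + p))
      volume volume := by
  have hm : Measurable (particle s j : Config k → Plane) := (continuous_particle s j).measurable
  have h : MeasurePreserving (fun q : Config k × (Bool × Fin p → Plane) =>
      (q.1, fun b => particle s j q.1 - q.2 b)) (volume.prod volume) (volume.prod volume) := by
    refine (MeasurePreserving.id volume).skew_product
      (g := fun x (r : Bool × Fin p → Plane) b => particle s j x - r b) ?_
      (Eventually.of_forall fun x => ?_)
    · exact measurable_pi_lambda _ fun b =>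
        (hm.comp measurable_fst).sub ((measurable_pi_apply b).comp measurable_snd)
    · exact (measurePreserving_pi (fun _ : Bool × Fin p => (volume : Measure Plane))
        (fun _ => volume) fun _ =>
          Measure.measurePreserving_sub_left volume (particle s j x)).map_eq
  exact (measurePreserving_joinConfig k p).comp
    ((Measure.measurePreserving_swap.comp h).comp Measure.measurePreserving_swap)

theorem contractionKernel_relativeConfig {k p : ℕ} (h : 𝓢(Plane, ℝ)) (ε : ℝ) (s : Bool)
    (j : Fin k) (q : (Bool × Fin p → Plane) × Config k) :
    contractionKernel h ε s j (relativeConfig s j q) = ∏ b, approxDelta h ε (q.1 b) := by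
  simp only [contractionKernel, relativeConfig, particle_castAdd_joinConfig,
    particle_natAdd_joinConfig, sub_sub_cancel]
  rw [Finset.prod_mul_distrib, Fintype.prod_prod_type, Fintype.prod_bool, mul_comm]

theorem inner_joinConfig {k p : ℕ} (q : (Bool × Fin p → Plane) × Config k)
    (ξ : Config (k + p)) : inner ℝ (joinConfig k p q) ξ =
      inner ℝ q.2 (firstParticles k p ξ) +
        ∑ b, inner ℝ (q.1 b) (particle b.1 (Fin.natAdd k b.2) ξ) := by
  simp only [PiLp.inner_apply, Fintype.sum_prod_type, Fin.sum_univ_add, firstParticles, particle,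
    joinConfig, Fin.addCases_left, Fin.addCases_right]
  rw [Finset.sum_add_distrib]

theorem inner_embedParticle {k : ℕ} (s : Bool) (j : Fin k) (x : Config k) (v : Plane) :
    inner ℝ x (embedParticle s j v) = inner ℝ (particle s j x) v := by
  simp only [PiLp.inner_apply, Fintype.sum_prod_type, embedParticle, particle]
  rw [Finset.sum_eq_single s, Finset.sum_eq_single j]
  · simp
  · intro i _ hi; simp [hi]
  · simp
  · intro s' _ hs; simp [hs]
  · simp

/-- Moving the particle at (s, j) now carries the contracted particles with it, so its dual variable
collects their frequencies. This is the origin of `contractFrequency`. -/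
theorem inner_relativeConfig {k p : ℕ} (s : Bool) (j : Fin k)
    (q : (Bool × Fin p → Plane) × Config k) (ξ : Config (k + p)) :
    inner ℝ (relativeConfig s j q) ξ = inner ℝ q.2 (contractFrequency s j ξ) -
      ∑ b, inner ℝ (q.1 b) (particle b.1 (Fin.natAdd k b.2) ξ) := by
  rw [relativeConfig, inner_joinConfig, contractFrequency, inner_add_right, inner_embedParticle,
    contractedSum, inner_sum]
  simp only [inner_sub_left, Finset.sum_sub_distrib]
  ring

theorem inner_spaceTimePoint {k : ℕ} (t t' : ℝ) (x x' : Config k) :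
    inner ℝ (spaceTimePoint t x) (spaceTimePoint t' x') = t * t' + inner ℝ x x' := by
  simp [PiLp.inner_apply, Fintype.sum_sum_type, spaceTimePoint, mul_comm]

theorem continuous_approxDelta (h : 𝓢(Plane, ℝ)) (ε : ℝ) : Continuous (approxDelta h ε) := by
  unfold approxDelta
  have := h.continuous
  fun_prop

theorem integrable_approxDelta (h : 𝓢(Plane, ℝ)) {ε : ℝ} (hε : ε ≠ 0) :
    Integrable (approxDelta h ε) := by
  unfold approxDelta
  exact ((integrable_comp_smul_iff volume h (inv_ne_zero hε)).2 h.integrable).const_mul _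

theorem exists_abs_approxDelta_le (h : 𝓢(Plane, ℝ)) (ε : ℝ) :
    ∃ M, ∀ y, |approxDelta h ε y| ≤ M := by
  refine ⟨(ε ^ 2)⁻¹ * SchwartzMap.seminorm ℝ 0 0 h, fun y => ?_⟩
  rw [approxDelta, abs_mul, abs_of_nonneg (by positivity)]
  gcongr
  exact SchwartzMap.norm_le_seminorm ℝ h _

/-- The Fourier transform of the approximation of the delta function. -/
def deltaSymbol (h : 𝓢(Plane, ℝ)) (ε : ℝ) (η : Plane) : ℂ :=
  ∫ r, (approxDelta h ε r : ℂ) * Complex.exp (-(2 * Real.pi * inner ℝ r η : ℝ) * Complex.I)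

/-- Scaling r by ε moves all dependence on ε into the phase; the bound by the L¹ norm of h and the
limit 1 are read off from this form. -/
theorem deltaSymbol_eq (h : 𝓢(Plane, ℝ)) {ε : ℝ} (hε : ε ≠ 0) (η : Plane) :
    deltaSymbol h ε η = ∫ r, (h r : ℂ) *
      Complex.exp (-(2 * Real.pi * (ε * inner ℝ r η) : ℝ) * Complex.I) := by
  have e := Measure.integral_comp_inv_smul (volume : Measure Plane) (fun r => (h r : ℂ) *
      Complex.exp (-(2 * Real.pi * (ε * inner ℝ r η) : ℝ) * Complex.I)) ε
  rw [finrank_euclideanSpace_fin, abs_of_nonneg (sq_nonneg ε)] at e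
  have hε2 : ((ε ^ 2 : ℝ) : ℂ) ≠ 0 := by exact_mod_cast pow_ne_zero 2 hε
  rw [Complex.real_smul] at e
  rw [← mul_right_inj' hε2, ← e, deltaSymbol, ← integral_const_mul]
  refine integral_congr_ae (Eventually.of_forall fun r => ?_)
  simp only [approxDelta, inner_smul_left, RCLike.conj_to_real, mul_inv_cancel_left₀ hε]
  push_cast at hε2 ⊢
  rw [← mul_assoc, ← mul_assoc, mul_inv_cancel₀ hε2, one_mul]

theorem norm_cexp_neg_mul_I (x : ℝ) : ‖Complex.exp (-(x : ℂ) * Complex.I)‖ = 1 := by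
  have := Complex.norm_exp_ofReal_mul_I (-x)
  rwa [Complex.ofReal_neg] at this

theorem norm_deltaSymbol_le (h : 𝓢(Plane, ℝ)) {ε : ℝ} (hε : ε ≠ 0) (η : Plane) :
    ‖deltaSymbol h ε η‖ ≤ ∫ r, ‖h r‖ := by
  rw [deltaSymbol_eq h hε]
  refine (norm_integral_le_integral_norm _).trans (le_of_eq ?_)
  refine integral_congr_ae (Eventually.of_forall fun r => ?_)
  simp only [norm_mul, norm_cexp_neg_mul_I, mul_one, Complex.norm_real]

theorem tendsto_deltaSymbol (h : 𝓢(Plane, ℝ)) (hh : ∫ y, h y = 1) (η : Plane) :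
    Tendsto (fun ε => deltaSymbol h ε η) (𝓝[>] 0) (𝓝 1) := by
  have hlim : Tendsto (fun ε : ℝ => ∫ r, (h r : ℂ) *
      Complex.exp (-(2 * Real.pi * (ε * inner ℝ r η) : ℝ) * Complex.I)) (𝓝[>] 0)
      (𝓝 (∫ r, (h r : ℂ))) := by
    refine tendsto_integral_filter_of_dominated_convergence (fun r => ‖h r‖)
      (Eventually.of_forall fun ε => ?_) (Eventually.of_forall fun ε => ?_) h.integrable.norm
      (Eventually.of_forall fun r => ?_)
    · have := h.continuous
      exact (by fun_prop : Continuous _).aestronglyMeasurable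
    · refine Eventually.of_forall fun r => ?_
      simp only [norm_mul, norm_cexp_neg_mul_I, mul_one, Complex.norm_real, le_refl]
    · refine Tendsto.mono_left ?_ nhdsWithin_le_nhds
      have : Continuous fun ε : ℝ => (h r : ℂ) *
        Complex.exp (-(2 * Real.pi * (ε * inner ℝ r η) : ℝ) * Complex.I) := by fun_prop
      simpa using this.tendsto 0
  have h1 : ∫ r, (h r : ℂ) = 1 := by rw [integral_complex_ofReal, hh, Complex.ofReal_one]
  rw [h1] at hlim
  refine hlim.congr' ?_
  filter_upwards [self_mem_nhdsWithin] with ε hε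
  exact (deltaSymbol_eq h (ne_of_gt hε) η).symm

theorem continuous_deltaSymbol (h : 𝓢(Plane, ℝ)) {ε : ℝ} (hε : ε ≠ 0) :
    Continuous (deltaSymbol h ε) := by
  unfold deltaSymbol
  refine continuous_of_dominated (bound := fun r => ‖approxDelta h ε r‖) (fun η => ?_)
    (fun η => Eventually.of_forall fun r => ?_) (integrable_approxDelta h hε).norm
    (Eventually.of_forall fun r => ?_)
  · have := continuous_approxDelta h ε
    exact (by fun_prop : Continuous _).aestronglyMeasurable
  · simp only [norm_mul, norm_cexp_neg_mul_I, mul_one, Complex.norm_real, le_refl]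
  · fun_prop

theorem norm_sq_spaceTimePoint {k : ℕ} (t : ℝ) (x : Config k) :
    ‖spaceTimePoint t x‖ ^ 2 = t ^ 2 + ‖x‖ ^ 2 := by
  rw [← real_inner_self_eq_norm_sq, inner_spaceTimePoint, real_inner_self_eq_norm_sq, sq t]

theorem exists_norm_schwartz_spaceTimePoint_le {k : ℕ} (Φ : 𝓢(SpaceTime k, ℂ)) :
    ∃ (φ : Config k → ℝ) (M : ℝ), Continuous φ ∧ Integrable φ ∧ (∀ x, 0 ≤ φ x) ∧ (∀ x, φ x ≤ M) ∧
      ∀ t x, ‖Φ (spaceTimePoint t x)‖ ≤ (1 + t ^ 2)⁻¹ * φ x := by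
  -- Of the 2 + m powers of decay used below, two pay for (1 + t²)⁻¹ and m, one more than the
  -- dimension, for integrability in x.
  obtain ⟨m, hm⟩ : ∃ m : ℕ, m = Module.finrank ℝ (Config k) + 1 := ⟨_, rfl⟩
  obtain ⟨C, hC⟩ : ∃ C : ℝ, ∀ w, (1 + ‖w‖) ^ (2 + m) * ‖Φ w‖ ≤ C := by
    refine ⟨2 ^ (2 + m) * (Finset.Iic (2 + m, 0)).sup
      (fun m => SchwartzMap.seminorm ℝ m.1 m.2) Φ, fun w => ?_⟩
    have h := SchwartzMap.one_add_le_sup_seminorm_apply (𝕜 := ℝ) (m := (2 + m, 0)) le_rfl le_rfl Φ w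
    rw [norm_iteratedFDeriv_zero] at h
    exact h
  have hC0 : 0 ≤ C := le_trans (by positivity) (hC 0)
  refine ⟨fun x => C * (1 + ‖x‖) ^ (-(m : ℝ)), C, ?_, ?_, fun x => by positivity, fun x => ?_,
    fun t x => ?_⟩
  · refine continuous_const.mul (Continuous.rpow_const (by fun_prop) fun x => Or.inl ?_)
    positivity
  · exact (integrable_one_add_norm (by rw [hm]; push_cast; linarith)).const_mul C
  · refine mul_le_of_le_one_right hC0 ?_
    exact Real.rpow_le_one_of_one_le_of_nonpos (by linarith [norm_nonneg x]) (by simp)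
  · have hn := norm_sq_spaceTimePoint t x
    have hx : ‖x‖ ≤ ‖spaceTimePoint t x‖ := by
      refine abs_le_of_sq_le_sq' ?_ (norm_nonneg _) |>.2
      nlinarith [sq_nonneg t]
    have ht : 1 + t ^ 2 ≤ (1 + ‖spaceTimePoint t x‖) ^ 2 := by
      nlinarith [norm_nonneg (spaceTimePoint t x), sq_nonneg ‖x‖]
    have h1 : (1 + t ^ 2) * (1 + ‖x‖) ^ m ≤ (1 + ‖spaceTimePoint t x‖) ^ (2 + m) := by
      rw [pow_add]
      exact mul_le_mul ht (pow_le_pow_left₀ (by positivity) (by linarith) _) (by positivity)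
        (by positivity)
    have h2 := (mul_le_mul_of_nonneg_right h1 (norm_nonneg (Φ (spaceTimePoint t x)))).trans (hC _)
    dsimp only
    rw [Real.rpow_neg (by positivity), Real.rpow_natCast, inv_mul_eq_div, ← div_eq_mul_inv,
      div_div, le_div_iff₀ (by positivity)]
    linarith

theorem integrable_comp_relativeConfig_iff {k p : ℕ} (s : Bool) (j : Fin k)
    {f : Config (k + p) → ℂ} (hf : Continuous f) :
    Integrable (fun q => f (relativeConfig s j q)) ↔ Integrable f :=
  (measurePreserving_relativeConfig s j).integrable_comp hf.aestronglyMeasurable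

theorem continuous_contractionKernel {k p : ℕ} (h : 𝓢(Plane, ℝ)) (ε : ℝ) (s : Bool)
    (j : Fin k) : Continuous (contractionKernel h ε s j : Config (k + p) → ℝ) := by
  unfold contractionKernel
  have h1 := continuous_approxDelta h ε
  have h2 : ∀ s i, Continuous (particle s i : Config (k + p) → Plane) := continuous_particle
  exact continuous_finsetProd _ fun l _ =>
    (h1.comp ((h2 _ _).sub (h2 _ _))).mul (h1.comp ((h2 _ _).sub (h2 _ _)))

theorem exists_abs_contractionKernel_le {k p : ℕ} (h : 𝓢(Plane, ℝ)) (ε : ℝ) (s : Bool)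
    (j : Fin k) : ∃ M, ∀ z : Config (k + p), |contractionKernel h ε s j z| ≤ M := by
  obtain ⟨M, hM⟩ := exists_abs_approxDelta_le h ε
  refine ⟨∏ _l : Fin p, M * M, fun z => ?_⟩
  rw [contractionKernel, Finset.abs_prod]
  refine Finset.prod_le_prod (fun _ _ => abs_nonneg _) fun l _ => ?_
  rw [abs_mul]
  exact mul_le_mul (hM _) (hM _) (abs_nonneg _) ((abs_nonneg _).trans (hM 0))

theorem integrable_mul_contractionKernel {k p : ℕ} (h : 𝓢(Plane, ℝ)) {ε : ℝ} (hε : ε ≠ 0)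
    (s : Bool) (j : Fin k) {φ : Config k → ℂ} (hφ : Continuous φ) (hφ1 : Integrable φ) :
    Integrable fun z : Config (k + p) =>
      φ (firstParticles k p z) * (contractionKernel h ε s j z : ℂ) := by
  have hK := continuous_contractionKernel (p := p) h ε s j
  have hF := continuous_firstParticles k p
  rw [← integrable_comp_relativeConfig_iff s j (by fun_prop)]
  simp only [contractionKernel_relativeConfig]
  have h1 : Integrable fun r : Bool × Fin p → Plane => ∏ b, (approxDelta h ε (r b) : ℂ) :=
    Integrable.fintype_prod (f := fun _ r => (approxDelta h ε r : ℂ))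
      fun b => (integrable_approxDelta h hε).ofReal
  refine (h1.mul_prod hφ1).congr (Eventually.of_forall fun q => ?_)
  simp only [relativeConfig, firstParticles_joinConfig]
  push_cast
  ring

theorem memLp_two_of_integrable_of_bounded {X : Type*} [MeasurableSpace X] {μ : Measure X}
    {f : X → ℂ} (hf : Integrable f μ) {M : ℝ} (hM : ∀ x, ‖f x‖ ≤ M) : MemLp f 2 μ := by
  rw [memLp_two_iff_integrable_sq_norm hf.1]
  simp only [sq]
  exact hf.norm.bdd_mul (c := M) hf.1.norm (Eventually.of_forall fun x => by simpa using hM x)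

section Regularized

variable {k p : ℕ} (h : 𝓢(Plane, ℝ)) (ε : ℝ) (s : Bool) (j : Fin k) (Φ : 𝓢(SpaceTime k, ℂ))

/-- The test function of the regularised contraction at time `t`. -/
def contractionTest (t : ℝ) (z : Config (k + p)) : ℂ :=
  Φ (spaceTimePoint t (firstParticles k p z)) * (contractionKernel h ε s j z : ℂ)

theorem continuous_contractionTest :
    Continuous fun q : ℝ × Config (k + p) => contractionTest h ε s j Φ q.1 q.2 := by
  unfold contractionTest
  have hK := continuous_contractionKernel (p := p) h ε s j
  have hF := continuous_firstParticles k p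
  have hS := continuous_spaceTimePoint k
  have hΦ := Φ.continuous
  exact (hΦ.comp (hS.comp (continuous_fst.prodMk (hF.comp continuous_snd)))).mul
    (Complex.continuous_ofReal.comp (hK.comp continuous_snd))

theorem continuous_contractionTest_time (t : ℝ) :
    Continuous (contractionTest h ε s j Φ t : Config (k + p) → ℂ) :=
  (continuous_contractionTest h ε s j Φ).comp (continuous_const.prodMk continuous_id)

variable {ε}

/-- A majorant separating t from z: L¹ and L² in z justify Parseval at each time, and the decay in t
justifies Fubini. -/
theorem exists_contractionTest_bound (hε : ε ≠ 0) :
    ∃ D : Config (k + p) → ℂ, Integrable D ∧ MemLp D 2 ∧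
    ∀ t z, ‖contractionTest h ε s j Φ t z‖ ≤ (1 + t ^ 2)⁻¹ * ‖D z‖ := by
  obtain ⟨φ, M, hφ, hφ1, hφ0, hφM, hb⟩ := exists_norm_schwartz_spaceTimePoint_le Φ
  obtain ⟨M', hM'⟩ := exists_abs_contractionKernel_le (p := p) h ε s j
  have hI := integrable_mul_contractionKernel (p := p) h hε s j (φ := fun x => (φ x : ℂ))
    (by fun_prop) hφ1.ofReal
  refine ⟨_, hI, memLp_two_of_integrable_of_bounded (M := M * M') hI fun z => ?_, fun t z => ?_⟩
  · rw [norm_mul, Complex.norm_real, Complex.norm_real]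
    refine mul_le_mul ?_ (hM' z) (norm_nonneg _) ((hφ0 0).trans (hφM 0))
    rw [Real.norm_of_nonneg (hφ0 _)]
    exact hφM _
  · rw [contractionTest, norm_mul, norm_mul, ← mul_assoc]
    gcongr
    rw [Complex.norm_real, Real.norm_of_nonneg (hφ0 _)]
    exact hb _ _

theorem integrable_contractionTest (hε : ε ≠ 0) (t : ℝ) :
    Integrable (contractionTest h ε s j Φ t : Config (k + p) → ℂ) := by
  obtain ⟨D, h1, -, hD⟩ := exists_contractionTest_bound (p := p) h s j Φ hε
  exact (h1.norm.const_mul _).mono'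
    (continuous_contractionTest_time h ε s j Φ t).aestronglyMeasurable
    (Eventually.of_forall (hD t))

theorem memLp_contractionTest (hε : ε ≠ 0) (t : ℝ) :
    MemLp (contractionTest h ε s j Φ t : Config (k + p) → ℂ) 2 := by
  obtain ⟨D, -, h2, hD⟩ := exists_contractionTest_bound (p := p) h s j Φ hε
  exact h2.of_le_mul (continuous_contractionTest_time h ε s j Φ t).aestronglyMeasurable
    (Eventually.of_forall (hD t))

/-- In relative coordinates both the kernel and the exponential factorise, so the transform is a
product of transforms of δ_ε and one spatial transform of Φ. -/
theorem fourierInv_contractionTest (t : ℝ) (ξ : Config (k + p)) :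
    𝓕⁻ (contractionTest h ε s j Φ t) ξ =
      (∏ b : Bool × Fin p, deltaSymbol h ε (particle b.1 (Fin.natAdd k b.2) ξ)) *
      ∫ x, Complex.exp (↑(2 * Real.pi * inner ℝ x (contractFrequency s j ξ)) * Complex.I) *
        Φ (spaceTimePoint t x) := by
  have hc : Continuous fun z : Config (k + p) =>
      Complex.exp (↑(2 * Real.pi * inner ℝ z ξ) * Complex.I) • contractionTest h ε s j Φ t z := by
    have := continuous_contractionTest_time (p := p) h ε s j Φ t
    fun_prop
  have hmp := measurePreserving_relativeConfig (p := p) s j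
  rw [Real.fourierInv_eq', ← hmp.map_eq, integral_map hmp.aemeasurable hc.aestronglyMeasurable]
  unfold deltaSymbol
  rw [← integral_fintype_prod_volume_eq_prod (fun (b : Bool × Fin p) r => (approxDelta h ε r : ℂ) *
    Complex.exp (-(2 * Real.pi * inner ℝ r (particle b.1 (Fin.natAdd k b.2) ξ) : ℝ) * Complex.I)),
    ← integral_prod_mul, Measure.volume_eq_prod]
  refine integral_congr_ae (Eventually.of_forall fun q => ?_)
  simp only [smul_eq_mul, contractionTest, contractionKernel_relativeConfig, inner_relativeConfig]
  rw [relativeConfig, firstParticles_joinConfig, Finset.prod_mul_distrib, ← Complex.exp_sum,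
    mul_sub, Complex.ofReal_sub, sub_mul, sub_eq_add_neg, Complex.exp_add]
  have : -(((2 * Real.pi * ∑ b, inner ℝ (q.1 b) (particle b.1 (Fin.natAdd k b.2) ξ) : ℝ) : ℂ) *
      Complex.I) = ∑ b : Bool × Fin p,
        -((2 * Real.pi * inner ℝ (q.1 b) (particle b.1 (Fin.natAdd k b.2) ξ) : ℝ) : ℂ) *
          Complex.I := by
    push_cast
    simp only [Finset.mul_sum, Finset.sum_mul, neg_mul, Finset.sum_neg_distrib]
  rw [this, Complex.ofReal_prod]
  ring

theorem fourierInv_spaceTimePoint (τ : ℝ) (ζ : Config k) :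
    𝓕⁻ Φ (spaceTimePoint τ ζ) = ∫ t : ℝ,
      (∫ x, Complex.exp (↑(2 * Real.pi * inner ℝ x ζ) * Complex.I) *
        Φ (spaceTimePoint t x)) * Complex.exp (Complex.I * (2 * Real.pi * t * τ : ℝ)) := by
  have hmp := measurePreserving_spaceTimePoint k
  have hc : Continuous fun w : SpaceTime k =>
      Complex.exp (↑(2 * Real.pi * inner ℝ w (spaceTimePoint τ ζ)) * Complex.I) • Φ w := by
    have := Φ.continuous
    fun_prop
  have hi : Integrable fun w : SpaceTime k =>
      Complex.exp (↑(2 * Real.pi * inner ℝ w (spaceTimePoint τ ζ)) * Complex.I) • Φ w := by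
    refine Φ.integrable.norm.mono' hc.aestronglyMeasurable (Eventually.of_forall fun w => ?_)
    rw [norm_smul, Complex.norm_exp_ofReal_mul_I, one_mul]
  rw [SchwartzMap.fourierInv_coe, Real.fourierInv_eq', ← hmp.map_eq,
    integral_map hmp.aemeasurable hc.aestronglyMeasurable]
  have hi' := (hmp.integrable_comp hc.aestronglyMeasurable).2 hi
  rw [Measure.volume_eq_prod] at hi' ⊢
  refine (integral_prod _ hi').trans (integral_congr_ae (Eventually.of_forall fun t => ?_))
  simp only
  rw [← integral_mul_const]
  refine integral_congr_ae (Eventually.of_forall fun x => ?_)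
  simp only [Function.comp_apply, smul_eq_mul, inner_spaceTimePoint]
  rw [mul_add, Complex.ofReal_add, add_mul, Complex.exp_add, mul_comm Complex.I,
    mul_assoc (2 * Real.pi)]
  ring

end Regularized

section Regularized

variable {k p : ℕ} (h : 𝓢(Plane, ℝ)) {ε : ℝ} (s : Bool) (j : Fin k) (Φ : 𝓢(SpaceTime k, ℂ))

theorem stronglyMeasurable_fourierInv_contractionTest :
    StronglyMeasurable fun q : ℝ × Config (k + p) =>
      𝓕⁻ (contractionTest h ε s j Φ q.1) q.2 := by
  simp only [Real.fourierInv_eq']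
  refine StronglyMeasurable.integral_prod_right
    (f := fun (q : ℝ × Config (k + p)) z =>
      Complex.exp (↑(2 * Real.pi * inner ℝ z q.2) * Complex.I) • contractionTest h ε s j Φ q.1 z) ?_
  refine Continuous.stronglyMeasurable ?_
  have hc := continuous_contractionTest (p := p) h ε s j Φ
  have h1 : Continuous fun r : (ℝ × Config (k + p)) × Config (k + p) =>
      contractionTest h ε s j Φ r.1.1 r.2 :=
    hc.comp ((continuous_fst.comp continuous_fst).prodMk continuous_snd)
  unfold Function.uncurry
  fun_prop

theorem integrable_prod_contractionTest (hε : ε ≠ 0)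
    (g : Lp ℂ 2 (volume : Measure (Config (k + p)))) :
    Integrable (fun q : ℝ × Config (k + p) =>
      𝓕⁻ (contractionTest h ε s j Φ q.1) q.2 * (freePhase q.1 q.2 * g q.2))
      (volume.prod volume) := by
  have hm : AEStronglyMeasurable (fun q : ℝ × Config (k + p) =>
      𝓕⁻ (contractionTest h ε s j Φ q.1) q.2 * (freePhase q.1 q.2 * g q.2))
      (volume.prod volume) :=
    (stronglyMeasurable_fourierInv_contractionTest h s j Φ).aestronglyMeasurable.mul
      (continuous_freePhase.aestronglyMeasurable.mul (Lp.aestronglyMeasurable g).comp_snd)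
  have hb := fun t => integral_norm_fourierInv_mul_le (integrable_contractionTest h s j Φ hε t)
    (memLp_contractionTest h s j Φ hε t) (evolveL2 t g)
  have hae : ∀ t, (fun ξ => 𝓕⁻ (contractionTest h ε s j Φ t) ξ * (evolveL2 t g) ξ) =ᵐ[volume]
      fun ξ => 𝓕⁻ (contractionTest h ε s j Φ t) ξ * (freePhase t ξ * g ξ) := by
    intro t
    filter_upwards [coeFn_evolveL2 t g] with ξ hξ
    rw [hξ]
  obtain ⟨D, -, hD2, hD⟩ := exists_contractionTest_bound (p := p) h s j Φ hε
  rw [integrable_prod_iff hm]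
  refine ⟨Eventually.of_forall fun t => (hb t).1.congr (hae t), ?_⟩
  refine (integrable_inv_one_add_sq.mul_const ((eLpNorm D 2 volume).toReal * ‖g‖)).mono'
    hm.norm.integral_prod_right' (Eventually.of_forall fun t => ?_)
  rw [Real.norm_of_nonneg (integral_nonneg fun _ => norm_nonneg _)]
  calc _ = ∫ ξ, ‖𝓕⁻ (contractionTest h ε s j Φ t) ξ * (evolveL2 t g) ξ‖ := by
        refine integral_congr_ae ?_
        filter_upwards [hae t] with ξ hξ
        rw [hξ]
    _ ≤ _ := (hb t).2
    _ ≤ ((1 + t ^ 2)⁻¹ * (eLpNorm D 2 volume).toReal) * ‖g‖ := by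
        rw [norm_evolveL2]
        refine mul_le_mul_of_nonneg_right ?_ (norm_nonneg _)
        have h1 := eLpNorm_le_mul_eLpNorm_of_ae_le_mul (μ := volume) (Eventually.of_forall (hD t)) 2
        refine (ENNReal.toReal_mono (ENNReal.mul_ne_top ENNReal.ofReal_ne_top hD2.2.ne) h1).trans
          (le_of_eq ?_)
        rw [ENNReal.toReal_mul, ENNReal.toReal_ofReal (by positivity)]
    _ = _ := by ring

/-- The regularised contraction in frequency variables. -/
theorem integral_contractionKernel_eq (hε : ε ≠ 0)
    {γ : ℝ → Lp ℂ 2 (volume : Measure (Config (k + p)))}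
    {γ₀ : Lp ℂ 2 (volume : Measure (Config (k + p)))} (hγ : IsFreeSolution γ γ₀) :
    ∫ t : ℝ, ∫ z : Config (k + p),
        Φ (spaceTimePoint t (firstParticles k p z)) * (contractionKernel h ε s j z : ℂ) * γ t z =
      ∫ ξ, (∏ b : Bool × Fin p, deltaSymbol h ε (particle b.1 (Fin.natAdd k b.2) ξ)) *
        (𝓕⁻ Φ (contractPoint s j ξ) * (𝓕 γ₀) ξ) := by
  have h1 : ∀ t, ∫ z : Config (k + p), Φ (spaceTimePoint t (firstParticles k p z)) *
      (contractionKernel h ε s j z : ℂ) * γ t z =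
      ∫ ξ, 𝓕⁻ (contractionTest h ε s j Φ t) ξ * (freePhase t ξ * (𝓕 γ₀) ξ) := by
    intro t
    refine (integral_mul_eq_integral_fourierInv_mul_fourier
      (integrable_contractionTest h s j Φ hε t) (memLp_contractionTest h s j Φ hε t) (γ t)).trans ?_
    rw [hγ.fourier_eq t]
    refine integral_congr_ae ?_
    filter_upwards [coeFn_evolveL2 t (𝓕 γ₀)] with ξ hξ
    rw [hξ]
  simp only [h1]
  -- With t innermost, the phase of the free evolution supplies the missing time transform of Φ, at
  -- time frequency ω(ξ).
  rw [integral_integral_swap (integrable_prod_contractionTest h s j Φ hε (𝓕 γ₀))]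
  refine integral_congr_ae (Eventually.of_forall fun ξ => ?_)
  simp only [fourierInv_contractionTest]
  rw [contractPoint, fourierInv_spaceTimePoint, ← integral_mul_const, ← integral_const_mul]
  refine integral_congr_ae (Eventually.of_forall fun t => ?_)
  simp only [freePhase]
  ring

theorem tendsto_integral_prod_deltaSymbol_mul (hh : ∫ y, h y = 1) {F : Config (k + p) → ℂ}
    (hF : Integrable F) :
    Tendsto (fun ε : ℝ => ∫ ξ,
        (∏ b : Bool × Fin p, deltaSymbol h ε (particle b.1 (Fin.natAdd k b.2) ξ)) * F ξ)
      (𝓝[>] 0) (𝓝 (∫ ξ, F ξ)) := by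
  have hpos : ∀ᶠ ε : ℝ in 𝓝[>] 0, ε ≠ 0 := by
    filter_upwards [self_mem_nhdsWithin] with ε hε using ne_of_gt hε
  refine tendsto_integral_filter_of_dominated_convergence
    (fun ξ => (∏ _b : Bool × Fin p, ∫ r, ‖h r‖) * ‖F ξ‖)
    (hpos.mono fun ε hε => ?_) (hpos.mono fun ε hε => Eventually.of_forall fun ξ => ?_)
    (hF.norm.const_mul _) (Eventually.of_forall fun ξ => ?_)
  · have hc : Continuous fun ξ : Config (k + p) =>
        ∏ b : Bool × Fin p, deltaSymbol h ε (particle b.1 (Fin.natAdd k b.2) ξ) :=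
      continuous_finsetProd _ fun b _ =>
        (continuous_deltaSymbol h hε).comp (continuous_particle _ _)
    exact hc.aestronglyMeasurable.mul hF.1
  · rw [norm_mul, norm_prod]
    refine mul_le_mul_of_nonneg_right ?_ (norm_nonneg _)
    exact Finset.prod_le_prod (fun _ _ => norm_nonneg _) fun b _ => norm_deltaSymbol_le h hε _
  · have := (tendsto_finsetProd Finset.univ fun (b : Bool × Fin p) _ =>
      tendsto_deltaSymbol h hh (particle b.1 (Fin.natAdd k b.2) ξ)).mul_const (F ξ)
    simpa using this

/-- The regularised contraction converges if the limit integral converges absolutely. -/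
theorem tendsto_integral_contractionKernel (hh : ∫ y, h y = 1)
    {γ : ℝ → Lp ℂ 2 (volume : Measure (Config (k + p)))}
    {γ₀ : Lp ℂ 2 (volume : Measure (Config (k + p)))} (hγ : IsFreeSolution γ γ₀)
    (hi : Integrable fun ξ : Config (k + p) => 𝓕⁻ Φ (contractPoint s j ξ) * (𝓕 γ₀) ξ) :
    Tendsto (fun ε : ℝ => ∫ t : ℝ, ∫ z : Config (k + p),
        Φ (spaceTimePoint t (firstParticles k p z)) * (contractionKernel h ε s j z : ℂ) * γ t z)
      (𝓝[>] 0) (𝓝 (∫ ξ, 𝓕⁻ Φ (contractPoint s j ξ) * (𝓕 γ₀) ξ)) := by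
  refine (tendsto_integral_prod_deltaSymbol_mul h hh hi).congr' ?_
  filter_upwards [self_mem_nhdsWithin] with ε hε
  exact (integral_contractionKernel_eq h s j Φ (ne_of_gt hε) hγ).symm

end Regularized

/-! ### Duality: constructing the contraction from the density bound -/

/-- Extension by density followed by the Riesz representation; the representing vector is conjugated
because the pairing is bilinear rather than sesquilinear. -/
theorem exists_l2Pairing_representation {E : Type*} [NormedAddCommGroup E] [InnerProductSpace ℝ E]
    [FiniteDimensional ℝ E] [MeasurableSpace E] [BorelSpace E] (Λ : 𝓢(E, ℂ) →ₗ[ℂ] ℂ) {c : ℝ}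
    (hc : 0 ≤ c) (hΛ : ∀ χ, ‖Λ χ‖ ≤ c * ‖schwartzL2 χ‖) :
    ∃ G : Lp ℂ 2 (volume : Measure E), ‖G‖ ≤ c ∧ ∀ χ, l2Pairing E (schwartzL2 χ) G = Λ χ := by
  set ℓ : Lp ℂ 2 (volume : Measure E) →L[ℂ] ℂ :=
    Λ.extendOfNorm (schwartzL2 : 𝓢(E, ℂ) →L[ℂ] Lp ℂ 2 (volume : Measure E)).toLinearMap with hℓ
  set x := (InnerProductSpace.toDual ℂ (Lp ℂ 2 (volume : Measure E))).symm ℓ with hx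
  have hxn : ‖x‖ ≤ c := by
    rw [hx, LinearIsometryEquiv.norm_map]
    exact LinearMap.opNorm_extendOfNorm_le denseRange_schwartzL2 hc hΛ
  refine ⟨star x, ?_, fun χ => ?_⟩
  · rw [Lp.norm_def, eLpNorm_congr_ae (Lp.coeFn_star x)]
    have : eLpNorm (star (x : E → ℂ)) 2 volume = eLpNorm x 2 volume :=
      eLpNorm_congr_norm_ae (Eventually.of_forall fun y => by simp)
    rwa [this, ← Lp.norm_def]
  · have h1 : ℓ (schwartzL2 χ) = Λ χ :=
      LinearMap.extendOfNorm_eq denseRange_schwartzL2 ⟨c, hΛ⟩ χ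
    rw [← h1, ← InnerProductSpace.toDual_symm_apply (y := ℓ), ← hx, L2.inner_def, l2Pairing_apply]
    refine integral_congr_ae ?_
    filter_upwards [Lp.coeFn_star x] with y hy
    rw [hy]
    simp

theorem sobolevSymbol_add {n : ℕ} (α β : ℝ) (ξ : Config n) :
    sobolevSymbol (α + β) ξ = sobolevSymbol α ξ * sobolevSymbol β ξ := by
  simp only [sobolevSymbol_eq_prod, ← Finset.prod_mul_distrib]
  refine Finset.prod_congr rfl fun s _ => Finset.prod_congr rfl fun i _ => ?_
  rw [← Real.rpow_add (japaneseSq_pos _)]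
  congr 1
  ring

theorem sobolevSymbol_zero {n : ℕ} (ξ : Config n) : sobolevSymbol 0 ξ = 1 := by
  simp [sobolevSymbol]

theorem sobolevSymbol_mul_neg {n : ℕ} (α : ℝ) (ξ : Config n) :
    sobolevSymbol α ξ * sobolevSymbol (-α) ξ = 1 := by
  rw [← sobolevSymbol_add, add_neg_cancel, sobolevSymbol_zero]

theorem sobolevOpSpaceTime_sobolevOpSpaceTime_neg (n : ℕ) (α : ℝ) (u : 𝓢'(SpaceTime n, ℂ)) :
    sobolevOpSpaceTime n α (sobolevOpSpaceTime n (-α) u) = u := by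
  unfold sobolevOpSpaceTime
  rw [TemperedDistribution.fourierMultiplierCLM_fourierMultiplierCLM_apply
    (sobolevSymbol_spatialPart_hasTemperateGrowth _)
    (sobolevSymbol_spatialPart_hasTemperateGrowth _)]
  have : ((fun w : SpaceTime n => (sobolevSymbol (-α) (spatialPart w) : ℂ)) *
      fun w => (sobolevSymbol α (spatialPart w) : ℂ)) = fun _ => 1 := by
    funext w
    rw [Pi.mul_apply, ← Complex.ofReal_mul, mul_comm, sobolevSymbol_mul_neg, Complex.ofReal_one]
  rw [this, TemperedDistribution.fourierMultiplierCLM_const]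
  simp

theorem fourier_eq_sobolevSymbol_mul {n : ℕ} {α : ℝ} {f g : Lp ℂ 2 (volume : Measure (Config n))}
    (h : Lp.toTemperedDistribution f = sobolevOp n α (Lp.toTemperedDistribution g)) :
    (𝓕 f : Lp ℂ 2 (volume : Measure (Config n))) =ᵐ[volume]
      fun ξ => (sobolevSymbol α ξ : ℂ) * (𝓕 g : Lp ℂ 2 (volume : Measure (Config n))) ξ := by
  have hσ : Continuous fun ξ : Config n => (sobolevSymbol α ξ : ℂ) :=
    Complex.continuous_ofReal.comp (continuous_sobolevSymbol α)
  refine ae_eq_of_integral_schwartz_mul_eq ((Lp.memLp _).locallyIntegrable (by norm_num))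
    (((Lp.memLp (𝓕 g)).locallyIntegrable (by norm_num)).continuous_mul hσ) fun ψ => ?_
  rw [← l2Pairing_schwartzL2, l2Pairing_schwartzL2_fourier, l2Pairing_schwartzL2_eq_apply, h,
    sobolevOp, TemperedDistribution.fourierMultiplierCLM_apply_apply, fourierInv_fourier_eq,
    ← l2Pairing_schwartzL2_eq_apply, ← l2Pairing_schwartzL2_fourier, l2Pairing_schwartzL2]
  refine integral_congr_ae (Eventually.of_forall fun ξ => ?_)
  simp only [SchwartzMap.smulLeftCLM_apply_apply (sobolevSymbol_hasTemperateGrowth α), smul_eq_mul]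
  ring

theorem l2Norm_toTemperedDistribution {E : Type*} [NormedAddCommGroup E] [InnerProductSpace ℝ E]
    [FiniteDimensional ℝ E] [MeasurableSpace E] [BorelSpace E]
    (g : Lp ℂ 2 (volume : Measure E)) : l2Norm (Lp.toTemperedDistribution g) = ‖g‖ₑ := by
  refine le_antisymm (iInf_le_of_le g (iInf_le _ rfl)) (le_iInf₂ fun f hf => ?_)
  rw [toTemperedDistribution_injective hf]

theorem exists_of_l2Norm_lt_top {E : Type*} [NormedAddCommGroup E] [InnerProductSpace ℝ E]
    [FiniteDimensional ℝ E] [MeasurableSpace E] [BorelSpace E] {u : 𝓢'(E, ℂ)}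
    (hu : l2Norm u < ∞) : ∃ g : Lp ℂ 2 (volume : Measure E), Lp.toTemperedDistribution g = u := by
  unfold l2Norm at hu
  simp only [iInf_lt_iff] at hu
  obtain ⟨g, hg, -⟩ := hu
  exact ⟨g, hg⟩

section Contract

variable {k p : ℕ} (α : ℝ) (s : Bool) (j : Fin k)

/-- A function of the space-time frequency of the contraction, weighted by the quotient of the
symbols. -/
def contractPullback (χ : SpaceTime k → ℂ) (ξ : Config (k + p)) : ℂ :=
  ((sobolevSymbol α (contractFrequency s j ξ) / sobolevSymbol α ξ : ℝ) : ℂ) *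
    χ (contractPoint s j ξ)

theorem continuous_contractPullback {χ : SpaceTime k → ℂ} (hχ : Continuous χ) :
    Continuous (contractPullback α s j χ : Config (k + p) → ℂ) := by
  unfold contractPullback
  exact (Complex.continuous_ofReal.comp (((continuous_sobolevSymbol α).comp
    (continuous_contractFrequency s j)).div (continuous_sobolevSymbol α) fun ξ =>
      (sobolevSymbol_pos α ξ).ne')).mul (hχ.comp (continuous_contractPoint s j))

/-- The density bound applied to F = |χ|², with square roots taken. -/
theorem eLpNorm_contractPullback_le {C : ℝ≥0∞}
    (hC : ∀ F : SpaceTime k → ℝ≥0∞, Measurable F → ∫⁻ ξ : Config (k + p), ENNReal.ofReal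
        ((sobolevSymbol α (contractFrequency s j ξ) / sobolevSymbol α ξ) ^ 2) *
          F (contractPoint s j ξ) ≤ C * ∫⁻ w, F w)
    {χ : SpaceTime k → ℂ} (hχ : Continuous χ) :
    eLpNorm (contractPullback α s j χ : Config (k + p) → ℂ) 2 volume ≤
      C ^ (1 / 2 : ℝ) * eLpNorm χ 2 volume := by
  simp only [eLpNorm_eq_lintegral_rpow_enorm_toReal two_ne_zero ENNReal.ofNat_ne_top,
    ENNReal.toReal_ofNat]
  rw [← ENNReal.mul_rpow_of_nonneg _ _ (by norm_num)]
  refine ENNReal.rpow_le_rpow ?_ (by norm_num)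
  refine le_trans (le_of_eq (lintegral_congr fun ξ => ?_))
    (hC (fun w => ‖χ w‖ₑ ^ (2 : ℝ)) (hχ.measurable.enorm.pow_const _))
  rw [contractPullback, enorm_mul, ENNReal.mul_rpow_of_nonneg _ _ (by norm_num)]
  congr 1
  have h0 : 0 ≤ sobolevSymbol α (contractFrequency s j ξ) / sobolevSymbol α ξ :=
    (div_pos (sobolevSymbol_pos _ _) (sobolevSymbol_pos _ _)).le
  rw [← ofReal_norm, Complex.norm_real, Real.norm_of_nonneg h0,
    ENNReal.ofReal_rpow_of_nonneg h0 (by norm_num)]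
  norm_num

/-- The contraction of the free solution with data `γ₀`, where `𝓕 f = σ 𝓕 γ₀`. -/
theorem exists_isHalfContraction {C : ℝ≥0∞} (hCt : C ≠ ∞)
    (hC : ∀ F : SpaceTime k → ℝ≥0∞, Measurable F → ∫⁻ ξ : Config (k + p), ENNReal.ofReal
        ((sobolevSymbol α (contractFrequency s j ξ) / sobolevSymbol α ξ) ^ 2) *
          F (contractPoint s j ξ) ≤ C * ∫⁻ w, F w)
    {γ : ℝ → Lp ℂ 2 (volume : Measure (Config (k + p)))}
    {γ₀ f : Lp ℂ 2 (volume : Measure (Config (k + p)))} (hγ : IsFreeSolution γ γ₀)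
    (hf : Lp.toTemperedDistribution f = sobolevOp (k + p) α (Lp.toTemperedDistribution γ₀)) :
    ∃ H : Lp ℂ 2 (volume : Measure (SpaceTime k)), ‖H‖ ≤ (C ^ (1 / 2 : ℝ)).toReal * ‖f‖ ∧
      IsHalfContraction s j γ (sobolevOpSpaceTime k (-α) (Lp.toTemperedDistribution H)) := by
  have hCt' : C ^ (1 / 2 : ℝ) ≠ ∞ := ENNReal.rpow_ne_top_of_nonneg (by norm_num) hCt
  have hnorm : ∀ χ : 𝓢(SpaceTime k, ℂ), eLpNorm χ 2 volume = ‖schwartzL2 χ‖ₑ := fun χ => by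
    rw [Lp.enorm_def, eLpNorm_congr_ae (coeFn_schwartzL2 χ)]
  have hmem : ∀ χ : 𝓢(SpaceTime k, ℂ),
      MemLp (contractPullback α s j χ : Config (k + p) → ℂ) 2 := fun χ => by
    refine ⟨(continuous_contractPullback α s j χ.continuous).aestronglyMeasurable, ?_⟩
    refine (eLpNorm_contractPullback_le α s j hC χ.continuous).trans_lt ?_
    rw [hnorm]
    exact ENNReal.mul_lt_top hCt'.lt_top enorm_lt_top
  have hint : ∀ χ : 𝓢(SpaceTime k, ℂ),
      Integrable fun ξ : Config (k + p) => contractPullback α s j χ ξ * (𝓕 f) ξ :=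
    fun χ => (hmem χ).integrable_mul (Lp.memLp _)
  -- The functional that S^{(k,α)} of the half contraction induces in frequency variables; its L²
  -- bound is Cauchy–Schwarz with the pullback estimate.
  let Λ : 𝓢(SpaceTime k, ℂ) →ₗ[ℂ] ℂ :=
    { toFun := fun χ => ∫ ξ : Config (k + p), contractPullback α s j χ ξ * (𝓕 f) ξ
      map_add' := fun χ χ' => by
        rw [← integral_add (hint χ) (hint χ')]
        refine integral_congr_ae (Eventually.of_forall fun ξ => ?_)
        simp only [contractPullback, add_apply]
        ring
      map_smul' := fun c χ => by
        rw [RingHom.id_apply, smul_eq_mul, ← integral_const_mul]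
        refine integral_congr_ae (Eventually.of_forall fun ξ => ?_)
        simp only [contractPullback, smul_apply, smul_eq_mul]
        ring }
  have hΛ : ∀ χ, ‖Λ χ‖ ≤ ((C ^ (1 / 2 : ℝ)).toReal * ‖f‖) * ‖schwartzL2 χ‖ := fun χ => by
    have e : Λ χ = inner ℂ (star (𝓕 f)) (hmem χ).toLp := by
      rw [L2.inner_def]
      refine integral_congr_ae ?_
      filter_upwards [Lp.coeFn_star (𝓕 f), (hmem χ).coeFn_toLp] with ξ h1 h2
      rw [h1, h2]
      simp
    have hs : ‖star (𝓕 f)‖ = ‖f‖ := by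
      rw [← Lp.norm_fourier_eq f, Lp.norm_def, Lp.norm_def, eLpNorm_congr_ae (Lp.coeFn_star _)]
      congr 1
      exact eLpNorm_congr_norm_ae (Eventually.of_forall fun y => by simp)
    have hq : ‖(hmem χ).toLp‖ ≤ (C ^ (1 / 2 : ℝ)).toReal * ‖schwartzL2 χ‖ := by
      rw [Lp.norm_toLp, ← toReal_enorm (schwartzL2 χ), ← ENNReal.toReal_mul, ← hnorm]
      refine ENNReal.toReal_mono ?_ (eLpNorm_contractPullback_le α s j hC χ.continuous)
      rw [hnorm]
      exact ENNReal.mul_ne_top hCt' enorm_ne_top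
    rw [e]
    refine (norm_inner_le_norm _ _).trans ?_
    rw [hs]
    calc _ ≤ ‖f‖ * ((C ^ (1 / 2 : ℝ)).toReal * ‖schwartzL2 χ‖) :=
          mul_le_mul_of_nonneg_left hq (norm_nonneg _)
      _ = _ := by ring
  obtain ⟨G, hG, hGΛ⟩ := exists_l2Pairing_representation Λ (by positivity) hΛ
  refine ⟨𝓕⁻ G, by rwa [norm_l2_fourierInv], fun h hh Φ => ?_⟩
  -- With this test function the symbol of order -α cancels the numerator of the pullback weight,
  -- while the denominator cancels the symbol relating `𝓕 f` to `𝓕 γ₀`.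
  set m : 𝓢(SpaceTime k, ℂ) := SchwartzMap.smulLeftCLM ℂ
    (fun w : SpaceTime k => (sobolevSymbol (-α) (spatialPart w) : ℂ)) (𝓕⁻ Φ) with hm
  have hpoint : ∀ᵐ ξ : Config (k + p), contractPullback α s j m ξ * (𝓕 f) ξ =
      𝓕⁻ Φ (contractPoint s j ξ) * (𝓕 γ₀) ξ := by
    filter_upwards [fourier_eq_sobolevSymbol_mul hf] with ξ hξ
    rw [hξ, contractPullback, hm,
      SchwartzMap.smulLeftCLM_apply_apply (sobolevSymbol_spatialPart_hasTemperateGrowth _),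
      smul_eq_mul]
    have h1 : (sobolevSymbol α (contractFrequency s j ξ) : ℂ) *
        (sobolevSymbol (-α) (spatialPart (contractPoint s j ξ)) : ℂ) = 1 := by
      rw [contractPoint, spatialPart_spaceTimePoint, ← Complex.ofReal_mul, sobolevSymbol_mul_neg,
        Complex.ofReal_one]
    have h2 : (sobolevSymbol α ξ : ℂ) ≠ 0 := by exact_mod_cast (sobolevSymbol_pos α ξ).ne'
    push_cast
    field_simp
    linear_combination 𝓕⁻ Φ (contractPoint s j ξ) * (𝓕 γ₀) ξ * h1
  have hval : sobolevOpSpaceTime k (-α) (Lp.toTemperedDistribution (𝓕⁻ G)) Φ =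
      ∫ ξ : Config (k + p), 𝓕⁻ Φ (contractPoint s j ξ) * (𝓕 γ₀) ξ := by
    rw [sobolevOpSpaceTime, TemperedDistribution.fourierMultiplierCLM_apply_apply, ← hm,
      ← l2Pairing_schwartzL2_eq_apply, ← l2Pairing_schwartzL2_fourier, fourier_fourierInv_eq, hGΛ]
    exact integral_congr_ae hpoint
  rw [hval]
  exact tendsto_integral_contractionKernel h s j Φ hh hγ ((hint m).congr hpoint)

end Contract
-- Both halves together, and uniformity in p
theorem one_sub_one_div_mono_of_le {p p₀ : ℕ} (hp : 1 ≤ p) (hpp : p ≤ p₀) {α : ℝ}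
    (hα : 1 - 1 / (2 * (2 * (p₀ : ℝ) - 1)) < α) : 1 - 1 / (2 * (2 * (p : ℝ) - 1)) < α := by
  have h1 : (1 : ℝ) ≤ p := by exact_mod_cast hp
  have h2 : (p : ℝ) ≤ p₀ := by exact_mod_cast hpp
  have : 1 / (2 * (2 * (p₀ : ℝ) - 1)) ≤ 1 / (2 * (2 * (p : ℝ) - 1)) := by
    apply one_div_le_one_div_of_le <;> linarith
  linarith

theorem exists_isContraction (p : ℕ) (hp : 1 ≤ p) {α : ℝ}
    (hα : 1 - 1 / (2 * (2 * (p : ℝ) - 1)) < α) (hα1 : α < 1) :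
    ∃ C : ℝ≥0, ∀ (k : ℕ) (j : Fin k) (γ₀ : Lp ℂ 2 (volume : Measure (Config (k + p))))
      (γ : ℝ → Lp ℂ 2 (volume : Measure (Config (k + p)))),
      l2Norm (sobolevOp (k + p) α (Lp.toTemperedDistribution γ₀)) < ∞ →
      IsFreeSolution γ γ₀ →
      ∃ β : 𝓢'(SpaceTime k, ℂ), IsContraction j γ β ∧
        l2Norm (sobolevOpSpaceTime k α β) ≤
          C * l2Norm (sobolevOp (k + p) α (Lp.toTemperedDistribution γ₀)) := by
  obtain ⟨C, hCt, hC⟩ := exists_lintegral_contractPoint_le p hp hα hα1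
  set c : ℝ := (C ^ (1 / 2 : ℝ)).toReal with hc
  have hc0 : 0 ≤ c := ENNReal.toReal_nonneg
  -- One c for each of the two halves, by the triangle inequality.
  refine ⟨(2 * c).toNNReal, fun k j γ₀ γ hγ₀ hγ => ?_⟩
  obtain ⟨f, hf⟩ := exists_of_l2Norm_lt_top hγ₀
  obtain ⟨H, hH, hβ⟩ := exists_isHalfContraction α false j hCt (hC k false j) hγ hf
  obtain ⟨H', hH', hβ'⟩ := exists_isHalfContraction α true j hCt (hC k true j) hγ hf
  refine ⟨_, ⟨_, _, hβ, hβ', rfl⟩, ?_⟩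
  have e : Lp.toTemperedDistribution H - Lp.toTemperedDistribution H' =
      Lp.toTemperedDistribution (H - H') :=
    (map_sub (Lp.toTemperedDistributionCLM ℂ (volume : Measure (SpaceTime k)) 2) H H').symm
  rw [map_sub, sobolevOpSpaceTime_sobolevOpSpaceTime_neg, sobolevOpSpaceTime_sobolevOpSpaceTime_neg,
    e, ← hf, l2Norm_toTemperedDistribution, l2Norm_toTemperedDistribution]
  rw [← ofReal_norm, ← ofReal_norm, ← ENNReal.ofReal, ← ENNReal.ofReal_mul (by positivity)]
  refine ENNReal.ofReal_le_ofReal ((norm_sub_le _ _).trans ?_)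
  linarith

end

theorem theorem4p1 (p₀ : ℕ) (hp₀ : 1 ≤ p₀) (α : ℝ)
    (hα : 1 - 1 / (2 * (2 * (p₀ : ℝ) - 1)) < α) (hα1 : α < 1) :
    ∃ C : ℝ≥0, ∀ (p : ℕ), 1 ≤ p → p ≤ p₀ → ∀ (k : ℕ) (j : Fin k)
      (γ₀ : Lp ℂ 2 (volume : Measure (Config (k + p))))
      (γ : ℝ → Lp ℂ 2 (volume : Measure (Config (k + p)))),
      l2Norm (sobolevOp (k + p) α (Lp.toTemperedDistribution γ₀)) < ∞ →
      IsFreeSolution γ γ₀ →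
      ∃ β : 𝓢'(SpaceTime k, ℂ), IsContraction j γ β ∧
        l2Norm (sobolevOpSpaceTime k α β) ≤
          C * l2Norm (sobolevOp (k + p) α (Lp.toTemperedDistribution γ₀)) := by
  have h : ∀ p : ℕ, ∃ C : ℝ≥0, 1 ≤ p → p ≤ p₀ → ∀ (k : ℕ) (j : Fin k)
      (γ₀ : Lp ℂ 2 (volume : Measure (Config (k + p))))
      (γ : ℝ → Lp ℂ 2 (volume : Measure (Config (k + p)))),
      l2Norm (sobolevOp (k + p) α (Lp.toTemperedDistribution γ₀)) < ∞ →
      IsFreeSolution γ γ₀ →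
      ∃ β : 𝓢'(SpaceTime k, ℂ), IsContraction j γ β ∧
        l2Norm (sobolevOpSpaceTime k α β) ≤
          C * l2Norm (sobolevOp (k + p) α (Lp.toTemperedDistribution γ₀)) := by
    intro p
    by_cases hp : 1 ≤ p ∧ p ≤ p₀
    · obtain ⟨C, hC⟩ := exists_isContraction p hp.1 (one_sub_one_div_mono_of_le hp.1 hp.2 hα) hα1
      exact ⟨C, fun _ _ => hC⟩
    · exact ⟨0, fun h1 h2 => absurd ⟨h1, h2⟩ hp⟩
  choose C hC using h
  -- The sum dominates each constant with p ≤ p₀; the range ends at p₀ + 1 so as to include p₀.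
  refine ⟨∑ p ∈ Finset.range (p₀ + 1), C p, fun p hp hpp k j γ₀ γ hγ₀ hγ => ?_⟩
  obtain ⟨β, hβ, hn⟩ := hC p hp hpp k j γ₀ γ hγ₀ hγ
  refine ⟨β, hβ, hn.trans (mul_le_mul_left ?_ _)⟩
  exact_mod_cast Finset.single_le_sum (f := C) (fun _ _ => zero_le)
    (Finset.mem_range.2 (Nat.lt_succ_of_le hpp))
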